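/- Fix an ordinal $1\le\xi<\omega_1$. For a Polish space $(X,\tau)$, a function $f:X\to\mathbb R$ is of Baire class $0$ if it is continuous, and of Baire class $\zeta>0$ if it is the pointwise limit of a sequence of functions $f_n$ of Baire classes $\zeta_n<\zeta$. Let $\mathcal B_\zeta(\tau)$ be the set of functions of Baire class $\zeta$, and $\mathcal B_\xi(\mathbb R)$ the set of Baire class $\xi$ functions on $\mathbb R$ with its usual topology. *Ranks of derivatives.* For a monotone map $D$ on the closed subsets of $X$ with $D(F)\subseteq F$ put $D^0(F)=F$, $D^{\eta+1}(F)=D(D^\eta(F))$ and $D^\eta(F)=\bigcap_{\theta<\eta}D^\theta(F)$ for limit $\eta$; let $\mathrm{rk}(D)$ be the least $\eta$ with $D^\eta(X)=\emptyset$ if such an $\eta$ exists, and $\omega_1$ otherwise. *Oscillation rank.* $\beta_\tau(f)=\sup_{\varepsilon>0}\mathrm{rk}(D_{f,\varepsilon})$, where $D_{f,\varepsilon}(F)=\{x\in F:\omega(f,x,F)\ge\varepsilon\}$ and $$\omega(f,x,F)=\inf_{x\in U\text{ open}}\ \sup_{x_1,x_2\in U\cap F}|f(x_1)-f(x_2)|.$$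 *Convergence rank.* $\gamma_\tau(f)$ is the minimum of $\sup_{\varepsilon>0}\mathrm{rk}(D_{(f_n),\varepsilon})$ over all sequences $(f_n)$ of continuous functions converging pointwise to $f\in\mathcal B_1(\tau)$, where $D_{(f_n),\varepsilon}(F)=\{x\in F:\omega((f_n),x,F)\ge\varepsilon\}$ and $$\omega((f_n),x,F)=\inf_{x\in U\text{ open}}\ \inf_{N\in\mathbb N}\ \sup\{|f_m(y)-f_n(y)|: m,n\ge N,\ y\in U\cap F\}.$$ *The ranks on $\mathcal B_\xi$.* For $f\in\mathcal B_\xi(\tau)$ let $T_{f,\xi}$ be the set of Polish topologies $\tau'\supseteq\tau$ on $X$ with $\tau'\subseteq\boldsymbol\Sigma^0_\xi(\tau)$ and $f\in\mathcal B_1(\tau')$, and put $$\beta^*_\xi(f)=\min_{\tau'\in T_{f,\xi}}\beta_{\tau'}(f),\qquad \gamma^*_\xi(f)=\min_{\tau'\in T_{f,\xi}}\gamma_{\tau'}(f).$$ For ordinals write $\theta\lesssim\theta'$ if for every $1\le\eta<\omega_1$, $\theta'\le\omega^\eta$ implies $\theta\le\omega^\eta$ (ordinal exponentiation), and $\theta\approx\theta'$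 if $\theta\lesssim\theta'$ and $\theta'\lesssim\theta$. **Corollary.** For every $f\in\mathcal B_\xi(\mathbb R)$ the set $T_{f,\xi}$ is non-empty, and each of $\rho=\beta^*_\xi$ and $\rho=\gamma^*_\xi$ is a map $\mathcal B_\xi(\mathbb R)\to\omega_1$ such that 1. $\rho$ is unbounded in $\omega_1$; moreover, for every non-empty perfect set $P\subseteq\mathbb R$ (closed, without isolated points) and every $\zeta<\omega_1$ there is $f\in\mathcal B_\xi(\mathbb R)$ that is $0$ outside $P$ and satisfies $\rho(f)\ge\zeta$; 2. $\rho$ is translation-invariant: for all $f\in\mathcal B_\xi(\mathbb R)$ and $t\in\mathbb R$, the function $x\mapsto f(x+t)$ is in $\mathcal B_\xi(\mathbb R)$ and has the same $\rho$ as $f$; 3. $\rho$ is essentially linear: for all $f,g\in\mathcal B_\xi(\mathbb R)$ and $c\in\mathbb R\setminus\{0\}$, the functions $cf$ and $f+g$ are in $\mathcal B_\xi(\mathbb R)$, $\rho(cf)\approx\rho(f)$ and $\rho(f+g)\lesssim\max\{\rho(f),\rho(g)\}$; 4. for every closed $F\subseteq\mathbb R$ and $f\in\mathcal B_\xi(\mathbb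 R)$, the function $f\cdot\chi_F$ is in $\mathcal B_\xi(\mathbb R)$ and $\rho(f\cdot\chi_F)\lesssim\rho(f)$. -/

import Mathlib

open Set Filter Topology
open scoped Ordinal ENNReal

namespace BaireRank

/-! ### Comparison of ordinals -/

/-- `θ ≲ θ'`: for every `1 ≤ η < ω₁`, `θ' ≤ ω ^ η` implies `θ ≤ ω ^ η`. -/
def EssLE (θ θ' : Ordinal.{0}) : Prop :=
  ∀ η : Ordinal.{0}, 1 ≤ η → η < ω₁ → θ' ≤ ω ^ η → θ ≤ ω ^ η

/-- `θ ≈ θ'`: both `θ ≲ θ'` and `θ' ≲ θ`. -/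
def EssEq (θ θ' : Ordinal.{0}) : Prop :=
  EssLE θ θ' ∧ EssLE θ' θ

/-! ### Baire classes and the additive Borel classes -/

/-- `f` is of Baire class `ξ`: the functions of class `0` are the continuous ones, and the functions
of class `ξ > 0` are the pointwise limits of sequences of functions of classes `< ξ`.
(For `ξ = 0` the second clause is void.) -/
inductive IsBaireClass {X : Type} [TopologicalSpace X] : Ordinal.{0} → (X → ℝ) → Prop
  | continuous (f : X → ℝ) (hf : Continuous f) : IsBaireClass 0 f
  | limit (ξ : Ordinal.{0}) (f : X → ℝ) (ξs : ℕ → Ordinal.{0}) (fs : ℕ → X → ℝ)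
      (hξ : ∀ n, ξs n < ξ) (hfs : ∀ n, IsBaireClass (ξs n) (fs n))
      (hlim : ∀ x, Tendsto (fun n => fs n x) atTop (𝓝 (f x))) : IsBaireClass ξ f

/-- `A ∈ Σ⁰_ξ`, for `ξ ≥ 1`: the `Σ⁰_1` sets are the open sets, and for `ξ > 1` the `Σ⁰_ξ` sets are
the countable unions of sets `A n` that are `Π⁰_(ηs n)`, i.e. have a `Σ⁰_(ηs n)` complement, with
`1 ≤ ηs n < ξ`. (No set is `Σ⁰_0`.) -/
inductive IsSigma0 {X : Type} [TopologicalSpace X] : Ordinal.{0} → Set X → Prop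
  | isOpen (U : Set X) (hU : IsOpen U) : IsSigma0 1 U
  | iUnion (ξ : Ordinal.{0}) (ηs : ℕ → Ordinal.{0}) (A : ℕ → Set X)
      (h1 : ∀ n, 1 ≤ ηs n) (hξ : ∀ n, ηs n < ξ) (hA : ∀ n, IsSigma0 (ηs n) (A n)ᶜ) :
      IsSigma0 ξ (⋃ n, A n)

/-! ### Derivatives and their ranks -/

/-- The iterated derivatives: `D⁰(F) = F`, `D^(η+1)(F) = D(D^η(F))`, and
`D^η(F) = ⋂ θ < η, D^θ(F)` for limit `η`. -/
noncomputable def iterDeriv {X : Type} (D : Set X → Set X) (F : Set X) (η : Ordinal.{0}) : Set X :=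
  Ordinal.limitRecOn η F (fun _ A => D A) (fun η _ A => ⋂ (θ : Ordinal.{0}) (h : θ < η), A θ h)

open Classical in
/-- The rank of a derivative `D` on `X`: the least `η` with `D^η(X) = ∅` if there is such an `η`,
and `ω₁` otherwise. -/
noncomputable def derivRank {X : Type} (D : Set X → Set X) : Ordinal.{0} :=
  if ∃ η : Ordinal.{0}, iterDeriv D univ η = ∅ then
    sInf {η : Ordinal.{0} | iterDeriv D univ η = ∅}
  else ω₁

/-! ### The oscillation rank `β` -/

/-- `D_{f,ε}(F) = {x ∈ F | ω(f, x, F) ≥ ε}`, where `ω(f, x, F)` is the oscillation at `x` of `f`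
restricted to `F`, with value `∞` allowed. -/
noncomputable def oscDeriv {X : Type} [TopologicalSpace X] (f : X → ℝ) (ε : ℝ) (F : Set X) :
    Set X :=
  {x ∈ F | ENNReal.ofReal ε ≤ oscillationWithin f F x}

/-- The oscillation rank `β(f) = sup_{ε > 0} rk(D_{f,ε})`. -/
noncomputable def beta {X : Type} [TopologicalSpace X] (f : X → ℝ) : Ordinal.{0} :=
  ⨆ ε : {ε : ℝ // 0 < ε}, derivRank (oscDeriv f ε)

/-! ### The convergence rank `γ` -/

/-- The oscillation of a sequence of functions at `x` restricted to `F`: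
`inf_{U ∋ x open} inf_N sup {|f_m(y) - f_n(y)| : m, n ≥ N, y ∈ U ∩ F}`, with value `∞` allowed. -/
noncomputable def seqOsc {X : Type} [TopologicalSpace X] (fs : ℕ → X → ℝ) (x : X) (F : Set X) :
    ℝ≥0∞ :=
  ⨅ (U : Set X) (_ : IsOpen U ∧ x ∈ U) (N : ℕ),
    ⨆ (m : ℕ) (_ : N ≤ m) (n : ℕ) (_ : N ≤ n) (y : X) (_ : y ∈ U ∩ F),
      ENNReal.ofReal |fs m y - fs n y|

/-- `D_{(f_n),ε}(F) = {x ∈ F | ω((f_n), x, F) ≥ ε}`. -/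
noncomputable def seqDeriv {X : Type} [TopologicalSpace X] (fs : ℕ → X → ℝ) (ε : ℝ) (F : Set X) :
    Set X :=
  {x ∈ F | ENNReal.ofReal ε ≤ seqOsc fs x F}

/-- The convergence rank `γ(f)`: the minimum of `sup_{ε > 0} rk(D_{(f_n),ε})` over all sequences
`(f_n)` of continuous functions that converge pointwise to `f`. -/
noncomputable def gamma {X : Type} [TopologicalSpace X] (f : X → ℝ) : Ordinal.{0} :=
  sInf {θ : Ordinal.{0} | ∃ fs : ℕ → X → ℝ, (∀ n, Continuous (fs n)) ∧
    (∀ x, Tendsto (fun n => fs n x) atTop (𝓝 (f x))) ∧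
    θ = ⨆ ε : {ε : ℝ // 0 < ε}, derivRank (seqDeriv fs ε)}

/-! ### The ranks `β*_ξ` and `γ*_ξ` -/

/-- `T_{f,ξ}`: the Polish topologies `τ'` on `X` that are finer than the given topology `τ`, consist
of `Σ⁰_ξ(τ)` sets, and make `f` a function of Baire class `1`.
(In Mathlib's order on topologies `τ' ≤ τ` means that `τ'` is finer than `τ`.) -/
def refinements {X : Type} [τ : TopologicalSpace X] (ξ : Ordinal.{0}) (f : X → ℝ) :
    Set (TopologicalSpace X) :=
  {τ' | τ' ≤ τ ∧ @PolishSpace X τ' ∧ (∀ U : Set X, IsOpen[τ'] U → @IsSigma0 X τ ξ U) ∧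
    @IsBaireClass X τ' 1 f}

/-- `β*_ξ(f)`: the minimum over `τ' ∈ T_{f,ξ}` of the oscillation rank of `f` with respect
to `τ'`. -/
noncomputable def betaStar {X : Type} [TopologicalSpace X] (ξ : Ordinal.{0}) (f : X → ℝ) :
    Ordinal.{0} :=
  sInf {θ : Ordinal.{0} | ∃ τ' ∈ refinements ξ f, θ = @beta X τ' f}

/-- `γ*_ξ(f)`: the minimum over `τ' ∈ T_{f,ξ}` of the convergence rank of `f` with respect
to `τ'`. -/
noncomputable def gammaStar {X : Type} [TopologicalSpace X] (ξ : Ordinal.{0}) (f : X → ℝ) :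
    Ordinal.{0} :=
  sInf {θ : Ordinal.{0} | ∃ τ' ∈ refinements ξ f, θ = @gamma X τ' f}

/-! ### The required properties -/

/-- The restriction of `ρ` to the Baire class `ξ` functions on `ℝ` is a map into `ω₁` with the four
required properties. -/
structure IsRequiredRank (ξ : Ordinal.{0}) (ρ : (ℝ → ℝ) → Ordinal.{0}) : Prop where
  /-- `ρ` takes countable ordinals as values. -/
  lt_omega_one : ∀ f : ℝ → ℝ, IsBaireClass ξ f → ρ f < ω₁
  /-- `ρ` is unbounded in `ω₁`. -/
  unbounded : ∀ ζ : Ordinal.{0}, ζ < ω₁ → ∃ f : ℝ → ℝ, IsBaireClass ξ f ∧ ζ ≤ ρ f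
  /-- `ρ` is unbounded even on the functions that vanish outside a given non-empty perfect set. -/
  unbounded_on_perfect : ∀ P : Set ℝ, Perfect P → P.Nonempty → ∀ ζ : Ordinal.{0}, ζ < ω₁ →
    ∃ f : ℝ → ℝ, IsBaireClass ξ f ∧ (∀ x, x ∉ P → f x = 0) ∧ ζ ≤ ρ f
  /-- `ρ` is translation-invariant. -/
  translation : ∀ f : ℝ → ℝ, IsBaireClass ξ f → ∀ t : ℝ,
    IsBaireClass ξ (fun x => f (x + t)) ∧ ρ (fun x => f (x + t)) = ρ f
  /-- `ρ` is essentially linear, first part. -/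
  smul : ∀ f : ℝ → ℝ, IsBaireClass ξ f → ∀ c : ℝ, c ≠ 0 →
    IsBaireClass ξ (fun x => c * f x) ∧ EssEq (ρ (fun x => c * f x)) (ρ f)
  /-- `ρ` is essentially linear, second part. -/
  add : ∀ f g : ℝ → ℝ, IsBaireClass ξ f → IsBaireClass ξ g →
    IsBaireClass ξ (fun x => f x + g x) ∧ EssLE (ρ (fun x => f x + g x)) (max (ρ f) (ρ g))
  /-- Multiplying by the characteristic function of a closed set essentially does not increase
  `ρ`. -/
  mul_indicator : ∀ f : ℝ → ℝ, IsBaireClass ξ f → ∀ F : Set ℝ, IsClosed F →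
    IsBaireClass ξ (fun x => f x * F.indicator (fun _ => (1 : ℝ)) x) ∧
      EssLE (ρ (fun x => f x * F.indicator (fun _ => (1 : ℝ)) x)) (ρ f)

end BaireRank

/-! Everything rests on replacing transfinite derivatives by ordinal-valued functions. A derivative
that deletes the relatively open small pieces exhausts the space by stage `θ` iff there is an upper
semicontinuous `r : X → θ` whose level sets are locally small (`hasIndex_iff`): take for `r x` the
stage at which `x` disappears. The permanence properties then become operations on indices. Sums of
functions correspond to natural sums of indices, and `ω ^ η` is closed under natural sums
(`HasIndex.and`); multiplication by `χ_F` raises the index by one on `F` and sets it to `0`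
elsewhere (`HasIndex.inter_isClosed`); translations pull back index and topology.

The set `T_{f,ξ}` is non-empty because `f` is a limit of functions whose preimages of open sets are
`Σ⁰_ξ`, and countably many `Σ⁰_ξ` sets can be made open in one Polish topology inside `Σ⁰_ξ`
(`refinements_nonempty`). In that topology `f` has Baire class `1`, so the Baire category theorem
and second countability give countable ranks (`exists_hasIndex_seqSmall`). Two refinements have a
common one, which is what sums need.

Unboundedness is a diagonal argument. If a characteristic function `χ_A` has rank at most `ζ` for
some refinement, its index yields `Σ⁰_ξ` sets `V i`, `W i` (`i < ζ`) such that membership of a point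
in `A` is decided by the first `i` with the point in `V i ∪ W i`. All such families are coded by
points of a Cantor set inside `P`, by means of a universal `Σ⁰_ξ` set; the set `A` that reverses at
each code the decision of the coded family defeats them all (`exists_indicator_not_separated`), and
`χ_A` is still of Baire class `ξ` (`isBaireClass_indicator_firstDiff`). -/

namespace BaireRank

/-! ### Natural sums of ordinals -/

/-- The natural (Hessenberg) sum: the least binary function on the ordinals that is strictly
monotone in both arguments. -/
noncomputable def natSum (a b : Ordinal.{0}) : Ordinal.{0} :=
  max (⨆ x : Iio a, natSum x.1 b + 1) (⨆ x : Iio b, natSum a x.1 + 1)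
termination_by (a, b)
decreasing_by
  · exact Prod.Lex.left _ _ x.2
  · exact Prod.Lex.right _ x.2

theorem natSum_lt_left {a a' : Ordinal.{0}} (b : Ordinal.{0}) (h : a' < a) :
    natSum a' b < natSum a b := by
  rw [natSum.eq_def a b, lt_max_iff]
  left
  rw [← Order.add_one_le_iff]
  exact Ordinal.le_iSup (fun x : Iio a => natSum x.1 b + 1) ⟨a', h⟩

theorem natSum_lt_right (a : Ordinal.{0}) {b b' : Ordinal.{0}} (h : b' < b) :
    natSum a b' < natSum a b := by
  rw [natSum.eq_def a b, lt_max_iff]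
  right
  rw [← Order.add_one_le_iff]
  exact Ordinal.le_iSup (fun x : Iio b => natSum a x.1 + 1) ⟨b', h⟩

theorem natSum_lt_of_lt_of_le {a a' b b' : Ordinal.{0}} (h : a' < a) (h' : b' ≤ b) :
    natSum a' b' < natSum a b := by
  rcases h'.eq_or_lt with rfl | h'
  · exact natSum_lt_left _ h
  · exact (natSum_lt_left _ h).trans (natSum_lt_right _ h')

theorem natSum_lt_of_le_of_lt {a a' b b' : Ordinal.{0}} (h : a' ≤ a) (h' : b' < b) :
    natSum a' b' < natSum a b := by
  rcases h.eq_or_lt with rfl | h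
  · exact natSum_lt_right _ h'
  · exact (natSum_lt_left _ h).trans (natSum_lt_right _ h')

theorem natSum_le {a b c : Ordinal.{0}} (h₁ : ∀ x < a, natSum x b < c)
    (h₂ : ∀ x < b, natSum a x < c) : natSum a b ≤ c := by
  rw [natSum]
  refine max_le (Ordinal.iSup_le fun x => ?_) (Ordinal.iSup_le fun x => ?_)
  · exact Order.add_one_le_of_lt (h₁ _ x.2)
  · exact Order.add_one_le_of_lt (h₂ _ x.2)

/-- Double induction on the two arguments. Lowering an argument either lowers its multiple of `ω ^
η`, and the hypothesis `H` keeps the new remainder below `ω ^ η`, or lowers its remainder, and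
strict monotonicity applies. -/
theorem natSum_opow_mul_add_le (η : Ordinal.{0}) (n m : ℕ) (a b : Ordinal.{0})
    (ha : a < ω ^ η) (hb : b < ω ^ η) (H : ∀ a < ω ^ η, ∀ b < ω ^ η, natSum a b < ω ^ η) :
    natSum (ω ^ η * n + a) (ω ^ η * m + b) ≤ ω ^ η * (n + m : ℕ) + natSum a b := by
  have split : ∀ (n : ℕ) (a : Ordinal.{0}), a < ω ^ η → ∀ x < ω ^ η * n + a,
      ∃ (n' : ℕ) (a' : Ordinal.{0}), a' < ω ^ η ∧ x = ω ^ η * n' + a' ∧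
        (n' < n ∨ n' = n ∧ a' < a) := by
    intro n a ha x hx
    have h0 : (ω : Ordinal.{0}) ^ η ≠ 0 := (Ordinal.opow_pos _ Ordinal.omega0_pos).ne'
    have hd := Ordinal.div_add_mod x (ω ^ η)
    have hm := Ordinal.mod_lt x h0
    have hlt : x / ω ^ η < (n + 1 : ℕ) := by
      rw [← Ordinal.lt_mul_iff_div_lt h0]
      refine hx.trans ?_
      push_cast
      rw [mul_add, mul_one]
      exact add_lt_add_right ha _
    obtain ⟨n', hn'⟩ := Ordinal.lt_omega0.1 (hlt.trans (Ordinal.natCast_lt_omega0 _))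
    refine ⟨n', x % ω ^ η, hm, by rw [← hn', hd], ?_⟩
    rw [hn', Nat.cast_lt] at hlt
    rcases Nat.lt_succ_iff_lt_or_eq.1 hlt with h | h
    · exact Or.inl h
    · refine Or.inr ⟨h, ?_⟩
      rw [← hd, hn', h] at hx
      exact lt_of_add_lt_add_left hx
  have cmp : ∀ (p q : ℕ) (u v : Ordinal.{0}), u < ω ^ η → p < q →
      ω ^ η * (p : Ordinal.{0}) + u < ω ^ η * (q : Ordinal.{0}) + v := by
    intro p q u v hu hpq
    have h1 : ω ^ η * (p : Ordinal.{0}) + u < ω ^ η * ((p + 1 : ℕ) : Ordinal.{0}) := by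
      push_cast
      rw [mul_add, mul_one]
      exact add_lt_add_right hu _
    refine h1.trans_le (le_trans ?_ le_self_add)
    gcongr
    exact_mod_cast hpq
  suffices ∀ s t : Ordinal.{0}, ∀ (n m : ℕ) (a b : Ordinal.{0}), a < ω ^ η → b < ω ^ η →
      s = ω ^ η * n + a → t = ω ^ η * m + b →
      natSum s t ≤ ω ^ η * (n + m : ℕ) + natSum a b from this _ _ n m a b ha hb rfl rfl
  intro s
  induction s using WellFoundedLT.induction with
  | ind s ihs =>
  intro t
  induction t using WellFoundedLT.induction with
  | ind t iht =>
  intro n m a b ha hb hs ht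
  refine natSum_le (fun x hx => ?_) (fun x hx => ?_)
  · obtain ⟨n', a', ha', hxe, hlt⟩ := split n a ha x (hs ▸ hx)
    refine (ihs x hx t n' m a' b ha' hb hxe ht).trans_lt ?_
    rcases hlt with h | ⟨rfl, h⟩
    · exact cmp _ _ _ _ (H _ ha' _ hb) (by omega)
    · exact add_lt_add_right (natSum_lt_left _ h) _
  · obtain ⟨m', b', hb', hxe, hlt⟩ := split m b hb x (ht ▸ hx)
    refine (iht x hx n m' a b' ha hb' hs hxe).trans_lt ?_
    rcases hlt with h | ⟨rfl, h⟩
    · exact cmp _ _ _ _ (H _ ha _ hb') (by omega)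
    · exact add_lt_add_right (natSum_lt_right _ h) _

/-- This closure property is the reason why ranks are compared only through powers of `ω`. -/
theorem natSum_lt_omega0_opow (η : Ordinal.{0}) :
    ∀ a < ω ^ η, ∀ b < ω ^ η, natSum a b < ω ^ η := by
  induction η using Ordinal.limitRecOn with
  | zero =>
    intro a ha b hb
    rw [Ordinal.opow_zero, Order.lt_one_iff] at *
    subst ha hb
    exact nonpos_iff_eq_zero.1 (natSum_le (fun x hx => absurd hx not_lt_zero)
      (fun x hx => absurd hx not_lt_zero))
  | add_one η ih =>
    intro a ha b hb
    have h0 : (ω : Ordinal.{0}) ^ η ≠ 0 := (Ordinal.opow_pos _ Ordinal.omega0_pos).ne'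
    have key : ∀ a < ω ^ (η + 1), ∃ n : ℕ, a = ω ^ η * n + a % ω ^ η := by
      intro a ha
      rw [Ordinal.opow_add_one, Ordinal.lt_mul_iff_div_lt h0] at ha
      obtain ⟨n, hn⟩ := Ordinal.lt_omega0.1 ha
      exact ⟨n, by rw [← hn, Ordinal.div_add_mod]⟩
    obtain ⟨n, hn⟩ := key a ha
    obtain ⟨m, hm⟩ := key b hb
    rw [hn, hm]
    refine (natSum_opow_mul_add_le η n m _ _ (Ordinal.mod_lt _ h0) (Ordinal.mod_lt _ h0)
      ih).trans_lt ?_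
    exact Ordinal.opow_mul_add_lt_opow (Ordinal.natCast_lt_omega0 _)
      (ih _ (Ordinal.mod_lt _ h0) _ (Ordinal.mod_lt _ h0)) (Order.lt_add_one_iff.2 le_rfl)
  | limit η hη ih =>
    intro a ha b hb
    rw [Ordinal.lt_opow_of_isSuccLimit Ordinal.omega0_ne_zero hη] at ha hb
    obtain ⟨c, hc, hac⟩ := ha
    obtain ⟨d, hd, hbd⟩ := hb
    have hmax : max c d < η := max_lt hc hd
    have mono : ∀ e ≤ max c d, (ω : Ordinal.{0}) ^ e ≤ ω ^ max c d := fun e he =>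
      Ordinal.opow_le_opow_right Ordinal.omega0_pos he
    exact (ih _ hmax a (hac.trans_le (mono _ (le_max_left _ _))) b
      (hbd.trans_le (mono _ (le_max_right _ _)))).trans_le
      (Ordinal.opow_le_opow_right Ordinal.omega0_pos hmax.le)

/-! ### Iterated derivatives -/

section IterDeriv

variable {X : Type} {D : Set X → Set X}

theorem iterDeriv_zero (D : Set X → Set X) (F : Set X) : iterDeriv D F 0 = F := by
  simp [iterDeriv]

theorem iterDeriv_add_one (D : Set X → Set X) (F : Set X) (η : Ordinal.{0}) :
    iterDeriv D F (η + 1) = D (iterDeriv D F η) := by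
  simp [iterDeriv]

theorem iterDeriv_limit (D : Set X → Set X) (F : Set X) {η : Ordinal.{0}}
    (hη : Order.IsSuccLimit η) :
    iterDeriv D F η = ⋂ (θ : Ordinal.{0}) (_ : θ < η), iterDeriv D F θ := by
  rw [iterDeriv, Ordinal.limitRecOn_limit _ _ _ _ hη]
  rfl

theorem iterDeriv_antitone (hD : ∀ F, D F ⊆ F) (F : Set X) : Antitone (iterDeriv D F) := by
  intro θ η h
  induction η using Ordinal.limitRecOn with
  | zero => rw [nonpos_iff_eq_zero.1 h]
  | add_one η ih =>
    rcases h.eq_or_lt with rfl | h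
    · exact le_rfl
    · rw [iterDeriv_add_one]
      exact (hD _).trans (ih (Order.lt_add_one_iff.1 h))
  | limit η hη ih =>
    rcases h.eq_or_lt with rfl | h
    · exact le_rfl
    · rw [iterDeriv_limit D F hη]
      exact biInter_subset_of_mem h

theorem exists_mem_iterDeriv_notMem_add_one {θ : Ordinal.{0}} {x : X}
    (hx : x ∉ iterDeriv D univ θ) :
    ∃ a < θ, x ∈ iterDeriv D univ a ∧ x ∉ iterDeriv D univ (a + 1) := by
  induction θ using Ordinal.limitRecOn with
  | zero => simp [iterDeriv_zero] at hx
  | add_one η ih =>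
    by_cases h : x ∈ iterDeriv D univ η
    · exact ⟨η, Order.lt_add_one_iff.2 le_rfl, h, hx⟩
    · obtain ⟨a, ha, h'⟩ := ih h
      exact ⟨a, ha.trans (Order.lt_add_one_iff.2 le_rfl), h'⟩
  | limit η hη ih =>
    rw [iterDeriv_limit D _ hη] at hx
    simp only [mem_iInter, not_forall] at hx
    obtain ⟨θ, hθ, hx⟩ := hx
    obtain ⟨a, ha, h'⟩ := ih θ hθ hx
    exact ⟨a, ha.trans hθ, h'⟩

/-- Each application of `D` deletes at least the points of minimal index, so the minimum of `r` on
what is left rises at every stage. -/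
theorem iterDeriv_subset_le_of_index (hD : ∀ F, D F ⊆ F) {r : X → Ordinal.{0}}
    (h : ∀ F, ∀ x ∈ F, (∀ y ∈ F, r x ≤ r y) → x ∉ D F) (θ : Ordinal.{0}) :
    iterDeriv D univ θ ⊆ {x | θ ≤ r x} := by
  induction θ using Ordinal.limitRecOn with
  | zero => exact fun x _ => (zero_le : 0 ≤ r x)
  | add_one η ih =>
    intro x hx
    rw [iterDeriv_add_one] at hx
    have hxη : η ≤ r x := ih (hD _ hx)
    refine Order.add_one_le_of_lt (hxη.lt_of_ne fun he => ?_)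
    exact h _ x (hD _ hx) (fun y hy => he ▸ ih hy) hx
  | limit η hη ih =>
    intro x hx
    rw [iterDeriv_limit D _ hη] at hx
    simp only [mem_iInter] at hx
    exact hη.le_iff_forall_le.2 fun θ hθ => ih θ hθ (hx θ hθ)

theorem derivRank_le {θ : Ordinal.{0}} (h : iterDeriv D univ θ = ∅) : derivRank D ≤ θ := by
  rw [derivRank, if_pos ⟨θ, h⟩]
  exact csInf_le' h

/-- The bound `θ < ω₁` excludes the default value `ω₁` of the rank, which carries no information
about emptiness. -/
theorem iterDeriv_eq_empty_of_derivRank_le (hD : ∀ F, D F ⊆ F) {θ : Ordinal.{0}}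
    (h : derivRank D ≤ θ) (hθ : θ < ω₁) : iterDeriv D univ θ = ∅ := by
  rw [derivRank] at h
  split_ifs at h with hex
  · have : iterDeriv D univ _ = ∅ := csInf_mem (s := {η | iterDeriv D univ η = ∅}) hex
    exact subset_empty_iff.1 (this ▸ iterDeriv_antitone hD univ h)
  · exact absurd (h.trans_lt hθ) (lt_irrefl _)

end IterDeriv

/-! ### Derivatives given by a local smallness condition -/

section LocDeriv

variable {X : Type} [TopologicalSpace X]

/-- The points of `F` near which no relatively open piece of `F` is small. -/
def locDeriv (s : Set X → Prop) (F : Set X) : Set X :=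
  {x ∈ F | ∀ U, IsOpen U → x ∈ U → ¬ s (U ∩ F)}

theorem locDeriv_subset (s : Set X → Prop) (F : Set X) : locDeriv s F ⊆ F := fun _ h => h.1

theorem isClosed_locDeriv (s : Set X → Prop) {F : Set X} (hF : IsClosed F) :
    IsClosed (locDeriv s F) := by
  rw [← isOpen_compl_iff, isOpen_iff_mem_nhds]
  intro x hx
  by_cases hxF : x ∈ F
  · have : ∃ U, IsOpen U ∧ x ∈ U ∧ s (U ∩ F) := by
      by_contra! h
      exact hx ⟨hxF, h⟩
    obtain ⟨U, hU, hxU, hs⟩ := this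
    filter_upwards [hU.mem_nhds hxU] with y hy hyD
    exact hyD.2 U hU hy hs
  · filter_upwards [hF.isOpen_compl.mem_nhds hxF] with y hy hyD
    exact hy hyD.1

theorem isClosed_iterDeriv_locDeriv (s : Set X → Prop) (η : Ordinal.{0}) :
    IsClosed (iterDeriv (locDeriv s) univ η) := by
  induction η using Ordinal.limitRecOn with
  | zero => rw [iterDeriv_zero]; exact isClosed_univ
  | add_one η ih => rw [iterDeriv_add_one]; exact isClosed_locDeriv s ih
  | limit η hη ih =>
    rw [iterDeriv_limit _ _ hη]
    exact isClosed_iInter fun θ => isClosed_iInter fun hθ => ih θ hθ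

/-- There is an ordinal-valued upper semicontinuous index, with values below `θ`, whose level sets
are locally small. -/
def HasIndex (s : Set X → Prop) (θ : Ordinal.{0}) : Prop :=
  ∃ r : X → Ordinal.{0}, (∀ x, r x < θ) ∧
    ∀ x, ∃ U, IsOpen U ∧ x ∈ U ∧ (∀ y ∈ U, r y ≤ r x) ∧ s (U ∩ {y | r y = r x})

/-- From an index, a point of minimal index in `F` has a neighbourhood meeting `F` only inside its
own level, so the derivative deletes it. Conversely, `r x` is the last stage containing `x`; an open
set that witnesses the deletion of `x` has no point surviving longer than `x`, which gives upper
semicontinuity. -/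
theorem hasIndex_iff {s : Set X → Prop} (hs : ∀ A B, A ⊆ B → s B → s A) {θ : Ordinal.{0}} :
    HasIndex s θ ↔ iterDeriv (locDeriv s) univ θ = ∅ := by
  constructor
  · rintro ⟨r, hr, h⟩
    refine eq_empty_of_forall_notMem fun x hx => ?_
    refine (hr x).not_ge (iterDeriv_subset_le_of_index (locDeriv_subset s) ?_ θ hx)
    intro F x hxF hF hxD
    obtain ⟨U, hU, hxU, hle, hsU⟩ := h x
    refine hxD.2 U hU hxU (hs _ _ ?_ hsU)
    exact fun y hy => ⟨hy.1, (hle y hy.1).antisymm (hF y hy.2)⟩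
  · intro h
    have hex : ∀ x, ∃ a < θ, x ∈ iterDeriv (locDeriv s) univ a ∧
        x ∉ iterDeriv (locDeriv s) univ (a + 1) := fun x =>
      exists_mem_iterDeriv_notMem_add_one (h ▸ notMem_empty x)
    choose r hr hmem hnot using hex
    refine ⟨r, hr, fun x => ?_⟩
    have : ∃ U, IsOpen U ∧ x ∈ U ∧ s (U ∩ iterDeriv (locDeriv s) univ (r x)) := by
      have := hnot x
      rw [iterDeriv_add_one] at this
      by_contra! h
      exact this ⟨hmem x, h⟩
    obtain ⟨U, hU, hxU, hsU⟩ := this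
    refine ⟨U, hU, hxU, fun y hy => ?_, hs _ _ ?_ hsU⟩
    · by_contra! hlt
      have := iterDeriv_antitone (locDeriv_subset s) univ (Order.add_one_le_of_lt hlt) (hmem y)
      rw [iterDeriv_add_one] at this
      exact this.2 U hU hy hsU
    · rintro y ⟨hyU, hy : r y = r x⟩
      exact ⟨hyU, hy ▸ hmem y⟩

theorem HasIndex.mono_right {s : Set X → Prop} {θ θ' : Ordinal.{0}} (h : HasIndex s θ)
    (hθ : θ ≤ θ') : HasIndex s θ' :=
  let ⟨r, hr, h⟩ := h
  ⟨r, fun x => (hr x).trans_le hθ, h⟩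

theorem HasIndex.imp {s s' : Set X → Prop} {θ : Ordinal.{0}} (h : HasIndex s θ)
    (hs : ∀ A, s A → s' A) : HasIndex s' θ := by
  obtain ⟨r, hr, h⟩ := h
  refine ⟨r, hr, fun x => ?_⟩
  obtain ⟨U, hU, hx, hle, hsU⟩ := h x
  exact ⟨U, hU, hx, hle, hs _ hsU⟩

theorem HasIndex.comp {X Y : Type} [TopologicalSpace X] [TopologicalSpace Y] {h : X → Y}
    (hh : Continuous h) {s : Set Y → Prop} {s' : Set X → Prop}
    (hs : ∀ A, s A → s' (h ⁻¹' A)) {θ : Ordinal.{0}} (H : HasIndex s θ) : HasIndex s' θ := by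
  obtain ⟨r, hr, H⟩ := H
  refine ⟨r ∘ h, fun x => hr _, fun x => ?_⟩
  obtain ⟨U, hU, hx, hle, hsU⟩ := H (h x)
  exact ⟨h ⁻¹' U, hU.preimage hh, hx, fun y hy => hle _ hy, hs _ hsU⟩

/-- The natural sum is strictly monotone in both arguments. Near `x` both indices are at most their
values at `x`, so the sum can keep its value only where both do, and its level set lies in both
level sets. -/
theorem HasIndex.and {s₀ s₁ s : Set X → Prop} (hs₀ : ∀ A B, A ⊆ B → s₀ B → s₀ A)
    (hs₁ : ∀ A B, A ⊆ B → s₁ B → s₁ A) (hs : ∀ A, s₀ A → s₁ A → s A) {η : Ordinal.{0}}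
    (h₀ : HasIndex s₀ (ω ^ η)) (h₁ : HasIndex s₁ (ω ^ η)) : HasIndex s (ω ^ η) := by
  obtain ⟨r₀, hr₀, h₀⟩ := h₀
  obtain ⟨r₁, hr₁, h₁⟩ := h₁
  refine ⟨fun x => natSum (r₀ x) (r₁ x), fun x => natSum_lt_omega0_opow η _ (hr₀ x) _ (hr₁ x),
    fun x => ?_⟩
  obtain ⟨U, hU, hxU, hleU, hsU⟩ := h₀ x
  obtain ⟨V, hV, hxV, hleV, hsV⟩ := h₁ x
  have key : ∀ y ∈ U ∩ V, natSum (r₀ y) (r₁ y) < natSum (r₀ x) (r₁ x) ∨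
      r₀ y = r₀ x ∧ r₁ y = r₁ x := by
    intro y hy
    rcases (hleU y hy.1).eq_or_lt with h | h
    · rcases (hleV y hy.2).eq_or_lt with h' | h'
      · exact Or.inr ⟨h, h'⟩
      · exact Or.inl (natSum_lt_of_le_of_lt h.le h')
    · exact Or.inl (natSum_lt_of_lt_of_le h (hleV y hy.2))
  refine ⟨U ∩ V, hU.inter hV, ⟨hxU, hxV⟩, fun y hy => ?_, hs _ (hs₀ _ _ ?_ hsU) (hs₁ _ _ ?_ hsV)⟩
  · rcases key y hy with h | ⟨h, h'⟩
    · exact h.le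
    · simp only [h, h', le_rfl]
  · rintro y ⟨hy, hyr : natSum (r₀ y) (r₁ y) = _⟩
    exact ⟨hy.1, ((key y hy).resolve_left hyr.not_lt).1⟩
  · rintro y ⟨hy, hyr : natSum (r₀ y) (r₁ y) = _⟩
    exact ⟨hy.2, ((key y hy).resolve_left hyr.not_lt).2⟩

/-- The index `0` is reserved for the open complement of `F`, so no level set mixes points of `F`
with points outside it. The shift by one on `F` costs nothing below a limit ordinal. -/
theorem HasIndex.inter_isClosed {s₀ s : Set X → Prop} (hs₀ : ∀ A B, A ⊆ B → s₀ B → s₀ A)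
    (hs : ∀ A B, A ⊆ B → s B → s A) {F : Set X} (hF : IsClosed F)
    (hin : ∀ A ⊆ F, s₀ A → s A) (hout : ∀ x ∉ F, ∃ U, IsOpen U ∧ x ∈ U ∧ s U)
    {θ : Ordinal.{0}} (hθ : Order.IsSuccLimit θ) (h₀ : HasIndex s₀ θ) : HasIndex s θ := by
  classical
  obtain ⟨r₀, hr₀, h₀⟩ := h₀
  refine ⟨fun x => if x ∈ F then r₀ x + 1 else 0, fun x => ?_, fun x => ?_⟩
  · dsimp only
    split_ifs
    · exact hθ.add_one_lt (hr₀ x)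
    · exact (zero_le).trans_lt (hr₀ x)
  by_cases hx : x ∈ F
  · obtain ⟨U, hU, hxU, hleU, hsU⟩ := h₀ x
    refine ⟨U, hU, hxU, fun y hy => ?_, ?_⟩
    · simp only [hx, if_true]
      split_ifs
      · gcongr
        exact hleU y hy
      · exact zero_le
    · have key : ∀ y, (if y ∈ F then r₀ y + 1 else 0) = (if x ∈ F then r₀ x + 1 else 0) →
          y ∈ F ∧ r₀ y = r₀ x := by
        intro y hy
        rw [if_pos hx] at hy
        split_ifs at hy with hyF
        · exact ⟨hyF, by simpa using hy⟩
        · exact absurd hy ((zero_le (a := r₀ x)).trans_lt (Order.lt_add_one_iff.2 le_rfl)).ne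
      refine hin _ (fun y hy => (key y hy.2).1) (hs₀ _ _ ?_ hsU)
      exact fun y hy => ⟨hy.1, (key y hy.2).2⟩
  · obtain ⟨U, hU, hxU, hsU⟩ := hout x hx
    refine ⟨U ∩ Fᶜ, hU.inter hF.isOpen_compl, ⟨hxU, hx⟩, fun y hy => ?_,
      hs _ _ (inter_subset_left.trans inter_subset_left) hsU⟩
    have : y ∉ F := hy.2
    simp [this]

/-- A strictly decreasing chain of closed sets in a second countable space is countable: each step
is marked by a basic open set that meets the old set and misses the new one, and distinct steps have
distinct marks. -/
theorem exists_hasIndex_lt_omega_one [SecondCountableTopology X] {s : Set X → Prop}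
    (hs : ∀ A B, A ⊆ B → s B → s A)
    (h : ∀ F : Set X, IsClosed F → F.Nonempty → ∃ x ∈ F, ∃ U, IsOpen U ∧ x ∈ U ∧ s (U ∩ F)) :
    ∃ θ < ω₁, HasIndex s θ := by
  by_contra! hne
  simp only [hasIndex_iff hs] at hne
  let B := TopologicalSpace.countableBasis X
  have hB := TopologicalSpace.isBasis_countableBasis X
  have key : ∀ η : Iio (ω₁ : Ordinal.{0}), ∃ b : B,
      (b.1 ∩ iterDeriv (locDeriv s) univ η.1).Nonempty ∧
        b.1 ∩ iterDeriv (locDeriv s) univ (η.1 + 1) = ∅ := by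
    intro η
    obtain ⟨x, hx, U, hU, hxU, hsU⟩ := h _ (isClosed_iterDeriv_locDeriv s η.1)
      (nonempty_iff_ne_empty.2 (hne η.1 η.2))
    obtain ⟨b, hb, hxb, hbU⟩ := hB.exists_subset_of_mem_open hxU hU
    refine ⟨⟨b, hb⟩, ⟨x, hxb, hx⟩, eq_empty_of_forall_notMem ?_⟩
    rintro y ⟨hyb, hy⟩
    rw [iterDeriv_add_one] at hy
    exact hy.2 U hU (hbU hyb) hsU
  choose b hb1 hb2 using key
  have lt_ne : ∀ η η', η < η' → b η ≠ b η' := by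
    intro η η' hlt he
    obtain ⟨x, hxb, hx⟩ := hb1 η'
    have := iterDeriv_antitone (locDeriv_subset s) univ (Order.add_one_le_of_lt hlt) hx
    exact notMem_empty x (hb2 η ▸ ⟨he ▸ hxb, this⟩)
  have inj : Function.Injective b := by
    intro η η' he
    by_contra hne
    rcases lt_or_gt_of_ne hne with hlt | hlt
    · exact lt_ne _ _ hlt he
    · exact lt_ne _ _ hlt he.symm
  have hBc : Countable B := (TopologicalSpace.countable_countableBasis X).to_subtype
  have hc : Countable (Iio (ω₁ : Ordinal.{0})) := inj.countable
  have := (Cardinal.mk_le_aleph0_iff).2 hc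
  rw [Cardinal.mk_Iio_ordinal] at this
  simp at this

end LocDeriv

/-! ### The oscillation and convergence derivatives -/

section Small

variable {X : Type}

/-- `f` varies by less than `ε` on `A`. -/
def OscSmall (f : X → ℝ) (ε : ℝ) (A : Set X) : Prop :=
  ∃ δ < ε, ∀ y ∈ A, ∀ z ∈ A, |f y - f z| ≤ δ

/-- The tails of the sequence `fs` vary by less than `ε`, uniformly on `A`. -/
def SeqSmall (fs : ℕ → X → ℝ) (ε : ℝ) (A : Set X) : Prop :=
  ∃ N, ∃ δ < ε, ∀ m, N ≤ m → ∀ n, N ≤ n → ∀ y ∈ A, |fs m y - fs n y| ≤ δ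

theorem OscSmall.subset (f : X → ℝ) (ε : ℝ) (A B : Set X) (h : A ⊆ B) (hB : OscSmall f ε B) :
    OscSmall f ε A :=
  let ⟨δ, hδ, H⟩ := hB
  ⟨δ, hδ, fun y hy z hz => H y (h hy) z (h hz)⟩

theorem SeqSmall.subset (fs : ℕ → X → ℝ) (ε : ℝ) (A B : Set X) (h : A ⊆ B)
    (hB : SeqSmall fs ε B) : SeqSmall fs ε A :=
  let ⟨N, δ, hδ, H⟩ := hB
  ⟨N, δ, hδ, fun m hm n hn y hy => H m hm n hn y (h hy)⟩

theorem SeqSmall.mono {fs : ℕ → X → ℝ} {ε ε' : ℝ} {A : Set X} (h : SeqSmall fs ε A)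
    (hε : ε ≤ ε') : SeqSmall fs ε' A :=
  let ⟨N, δ, hδ, H⟩ := h
  ⟨N, δ, hδ.trans_le hε, H⟩

theorem OscSmall.add {f g : X → ℝ} {ε : ℝ} {A : Set X} (hf : OscSmall f (ε / 2) A)
    (hg : OscSmall g (ε / 2) A) : OscSmall (fun x => f x + g x) ε A := by
  obtain ⟨δ, hδ, hf⟩ := hf
  obtain ⟨δ', hδ', hg⟩ := hg
  refine ⟨δ + δ', by linarith, fun y hy z hz => ?_⟩
  have e : f y + g y - (f z + g z) = (f y - f z) + (g y - g z) := by ring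
  rw [e]
  exact (abs_add_le _ _).trans (add_le_add (hf y hy z hz) (hg y hy z hz))

theorem SeqSmall.add {f g : ℕ → X → ℝ} {ε : ℝ} {A : Set X} (hf : SeqSmall f (ε / 2) A)
    (hg : SeqSmall g (ε / 2) A) : SeqSmall (fun n x => f n x + g n x) ε A := by
  obtain ⟨N, δ, hδ, hf⟩ := hf
  obtain ⟨N', δ', hδ', hg⟩ := hg
  refine ⟨max N N', δ + δ', by linarith, fun m hm n hn y hy => ?_⟩
  have e : f m y + g m y - (f n y + g n y) = (f m y - f n y) + (g m y - g n y) := by ring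
  rw [e]
  exact (abs_add_le _ _).trans (add_le_add
    (hf m ((le_max_left _ _).trans hm) n ((le_max_left _ _).trans hn) y hy)
    (hg m ((le_max_right _ _).trans hm) n ((le_max_right _ _).trans hn) y hy))

theorem OscSmall.const_mul {f : X → ℝ} {ε c : ℝ} (hc : c ≠ 0) {A : Set X}
    (hf : OscSmall f (ε / |c|) A) : OscSmall (fun x => c * f x) ε A := by
  obtain ⟨δ, hδ, hf⟩ := hf
  have hc' : 0 < |c| := abs_pos.2 hc
  refine ⟨|c| * δ, by rwa [lt_div_iff₀' hc'] at hδ, fun y hy z hz => ?_⟩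
  rw [← mul_sub, abs_mul]
  exact mul_le_mul_of_nonneg_left (hf y hy z hz) hc'.le

theorem SeqSmall.const_mul {f : ℕ → X → ℝ} {ε c : ℝ} (hc : c ≠ 0) {A : Set X}
    (hf : SeqSmall f (ε / |c|) A) : SeqSmall (fun n x => c * f n x) ε A := by
  obtain ⟨N, δ, hδ, hf⟩ := hf
  have hc' : 0 < |c| := abs_pos.2 hc
  refine ⟨N, |c| * δ, by rwa [lt_div_iff₀' hc'] at hδ, fun m hm n hn y hy => ?_⟩
  rw [← mul_sub, abs_mul]
  exact mul_le_mul_of_nonneg_left (hf m hm n hn y hy) hc'.le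

variable [TopologicalSpace X]

theorem oscDeriv_eq (f : X → ℝ) {ε : ℝ} (hε : 0 < ε) : oscDeriv f ε = locDeriv (OscSmall f ε) := by
  ext F x
  refine and_congr_right fun hxF => ?_
  rw [← not_iff_not]
  push Not
  constructor
  · intro h
    rw [oscillationWithin] at h
    simp only [iInf_lt_iff] at h
    obtain ⟨S, hS, h⟩ := h
    obtain ⟨U, hU, hxU, hUS⟩ := mem_nhdsWithin.1 (mem_map.1 hS)
    have hfin : Metric.ediam S ≠ ⊤ := (h.trans ENNReal.ofReal_lt_top).ne
    refine ⟨U, hU, hxU, (Metric.ediam S).toReal,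
      (ENNReal.lt_ofReal_iff_toReal_lt hfin).1 h, fun y hy z hz => ?_⟩
    have := Metric.edist_le_ediam_of_mem (show f y ∈ S from hUS hy) (show f z ∈ S from hUS hz)
    rw [← Real.dist_eq, dist_edist]
    exact ENNReal.toReal_mono hfin this
  · rintro ⟨U, hU, hxU, δ, hδ, h⟩
    refine lt_of_le_of_lt ?_ ((ENNReal.ofReal_lt_ofReal_iff hε).2 hδ)
    refine (iInf₂_le (f '' (U ∩ F)) (mem_map.2 (mem_nhdsWithin.2
      ⟨U, hU, hxU, subset_preimage_image f _⟩))).trans ?_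
    refine Metric.ediam_le ?_
    rintro _ ⟨y, hy, rfl⟩ _ ⟨z, hz, rfl⟩
    rw [edist_dist, Real.dist_eq]
    exact ENNReal.ofReal_le_ofReal (h y hy z hz)

theorem seqDeriv_eq (fs : ℕ → X → ℝ) {ε : ℝ} (hε : 0 < ε) :
    seqDeriv fs ε = locDeriv (SeqSmall fs ε) := by
  ext F x
  refine and_congr_right fun hxF => ?_
  rw [← not_iff_not]
  push Not
  constructor
  · intro h
    rw [seqOsc] at h
    simp only [iInf_lt_iff] at h
    obtain ⟨U, ⟨hU, hxU⟩, N, h⟩ := h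
    have hfin := (h.trans ENNReal.ofReal_lt_top).ne
    refine ⟨U, hU, hxU, N, _, (ENNReal.lt_ofReal_iff_toReal_lt hfin).1 h,
      fun m hm n hn y hy => ?_⟩
    refine (ENNReal.ofReal_le_iff_le_toReal hfin).1 ?_
    exact le_iSup₂_of_le m hm (le_iSup₂_of_le n hn
      (le_iSup₂ (f := fun y (_ : y ∈ U ∩ F) => ENNReal.ofReal |fs m y - fs n y|) y hy))
  · rintro ⟨U, hU, hxU, N, δ, hδ, h⟩
    refine lt_of_le_of_lt ?_ ((ENNReal.ofReal_lt_ofReal_iff hε).2 hδ)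
    refine (iInf₂_le_of_le U ⟨hU, hxU⟩ (iInf_le _ N)).trans ?_
    exact iSup₂_le fun m hm => iSup₂_le fun n hn => iSup₂_le fun y hy =>
      ENNReal.ofReal_le_ofReal (h m hm n hn y hy)

/-- The same index works: where the tails of the sequence vary little, `f` is uniformly close to the
single continuous function `fs N`. -/
theorem hasIndex_oscSmall_of_seqSmall {f : X → ℝ} {fs : ℕ → X → ℝ} (hfs : ∀ n, Continuous (fs n))
    (hlim : ∀ x, Tendsto (fun n => fs n x) atTop (𝓝 (f x))) {ε : ℝ} (hε : 0 < ε)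
    {θ : Ordinal.{0}} (h : HasIndex (SeqSmall fs (ε / 3)) θ) : HasIndex (OscSmall f ε) θ := by
  obtain ⟨r, hr, h⟩ := h
  refine ⟨r, hr, fun x => ?_⟩
  obtain ⟨U, hU, hxU, hle, N, δ, hδ, hs⟩ := h x
  -- Two points of `V` have `fs N`-values less than `ε / 3` apart; with two approximation errors `δ
  -- < ε / 3` the total stays below `ε`.
  let V := {y | |fs N y - fs N x| < ε / 6}
  have hV : IsOpen V := isOpen_lt (((hfs N).sub continuous_const).abs) continuous_const
  have hxV : x ∈ V := by simp only [V, mem_ofPred_eq, sub_self, abs_zero]; positivity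
  refine ⟨U ∩ V, hU.inter hV, ⟨hxU, hxV⟩, fun y hy => hle y hy.1, 2 * δ + ε / 3, by linarith, ?_⟩
  have key : ∀ y ∈ U ∩ {y | r y = r x}, |f y - fs N y| ≤ δ := fun y hy =>
    le_of_tendsto ((hlim y).sub_const _).abs
      (eventually_atTop.2 ⟨N, fun n hn => hs n hn N le_rfl y hy⟩)
  rintro y ⟨⟨hyU, hyV⟩, hy⟩ z ⟨⟨hzU, hzV⟩, hz⟩
  have h1 := abs_le.1 (key y ⟨hyU, hy⟩)
  have h2 := abs_le.1 (key z ⟨hzU, hz⟩)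
  have h3 := abs_lt.1 (show |fs N y - fs N x| < ε / 6 from hyV)
  have h4 := abs_lt.1 (show |fs N z - fs N x| < ε / 6 from hzV)
  rw [abs_le]
  constructor <;> linarith [h1.1, h1.2, h2.1, h2.2, h3.1, h3.2, h4.1, h4.2]

/-- By pointwise convergence a closed set is the union of countably many closed sets on which the
tails are uniformly small, and by the category theorem one of them has relative interior. Using only
`ε = 1 / (k + 1)` leaves a countable supremum, which stays below `ω₁`. -/
theorem exists_hasIndex_seqSmall [PolishSpace X] {f : X → ℝ} {fs : ℕ → X → ℝ}
    (hfs : ∀ n, Continuous (fs n)) (hlim : ∀ x, Tendsto (fun n => fs n x) atTop (𝓝 (f x))) :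
    ∃ θ < ω₁, ∀ ε : ℝ, 0 < ε → HasIndex (SeqSmall fs ε) θ := by
  have key : ∀ ε : ℝ, 0 < ε → ∃ θ < ω₁, HasIndex (SeqSmall fs ε) θ := by
    intro ε hε
    refine exists_hasIndex_lt_omega_one (SeqSmall.subset fs ε) fun F hF hne => ?_
    have : PolishSpace F := hF.polishSpace
    have : Nonempty F := hne.to_subtype
    let C : ℕ → Set F := fun N => {y | ∀ m, N ≤ m → ∀ n, N ≤ n → |fs m y - fs n y| ≤ ε / 2}
    have hC : ∀ N, IsClosed (C N) := by
      intro N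
      simp only [C, ofPred_forall]
      refine isClosed_iInter fun m => isClosed_iInter fun _ => isClosed_iInter fun n =>
        isClosed_iInter fun _ => ?_
      exact isClosed_le ((((hfs m).comp continuous_subtype_val).sub
        ((hfs n).comp continuous_subtype_val)).abs) continuous_const
    have hun : ⋃ N, C N = univ := by
      refine eq_univ_of_forall fun y => mem_iUnion.2 ?_
      obtain ⟨N, hN⟩ := Metric.cauchySeq_iff.1 (hlim y).cauchySeq (ε / 2) (half_pos hε)
      exact ⟨N, fun m hm n hn => (hN m hm n hn).le⟩
    let := TopologicalSpace.upgradeIsCompletelyMetrizable F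
    obtain ⟨N, y, hy⟩ := nonempty_interior_of_iUnion_of_closed hC hun
    obtain ⟨U, hU, hUC⟩ := isOpen_induced_iff.1 (isOpen_interior (s := C N))
    have hyU : y.1 ∈ U := by
      have : y ∈ Subtype.val ⁻¹' U := hUC ▸ hy
      exact this
    refine ⟨y, y.2, U, hU, hyU, N, ε / 2, half_lt_self hε, fun m hm n hn z hz => ?_⟩
    have : (⟨z, hz.2⟩ : F) ∈ interior (C N) := by
      rw [← hUC]
      exact hz.1
    exact interior_subset this m hm n hn
  have hpos : ∀ k : ℕ, (0 : ℝ) < 1 / ((k : ℝ) + 1) := fun k => by positivity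
  choose θ hθ hI using fun k : ℕ => key (1 / ((k : ℝ) + 1)) (hpos k)
  refine ⟨⨆ k, θ k, Ordinal.iSup_lt_omega_one hθ, fun ε hε => ?_⟩
  obtain ⟨k, hk⟩ := exists_nat_one_div_lt hε
  exact ((hI k).mono_right (Ordinal.le_iSup θ k)).imp fun A hA => hA.mono hk.le

theorem beta_le {f : X → ℝ} {θ : Ordinal.{0}} (h : ∀ ε : ℝ, 0 < ε → HasIndex (OscSmall f ε) θ) :
    beta f ≤ θ := by
  refine Ordinal.iSup_le fun ε => derivRank_le ?_
  rw [oscDeriv_eq f ε.2]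
  exact (hasIndex_iff (OscSmall.subset f ε)).1 (h ε ε.2)

theorem hasIndex_of_beta_le {f : X → ℝ} {θ : Ordinal.{0}} (h : beta f ≤ θ) (hθ : θ < ω₁) {ε : ℝ}
    (hε : 0 < ε) : HasIndex (OscSmall f ε) θ := by
  rw [hasIndex_iff (OscSmall.subset f ε)]
  refine iterDeriv_eq_empty_of_derivRank_le (locDeriv_subset _) (le_trans ?_ h) hθ
  rw [← oscDeriv_eq f hε]
  exact Ordinal.le_iSup (fun ε : {ε : ℝ // 0 < ε} => derivRank (oscDeriv f ε)) ⟨ε, hε⟩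

theorem gamma_le {f : X → ℝ} {fs : ℕ → X → ℝ} (hfs : ∀ n, Continuous (fs n))
    (hlim : ∀ x, Tendsto (fun n => fs n x) atTop (𝓝 (f x))) {θ : Ordinal.{0}}
    (h : ∀ ε : ℝ, 0 < ε → HasIndex (SeqSmall fs ε) θ) : gamma f ≤ θ := by
  have hle : gamma f ≤ ⨆ ε : {ε : ℝ // 0 < ε}, derivRank (seqDeriv fs ε) :=
    csInf_le' ⟨fs, hfs, hlim, rfl⟩
  refine hle.trans (Ordinal.iSup_le fun ε => derivRank_le ?_)
  rw [seqDeriv_eq fs ε.2]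
  exact (hasIndex_iff (SeqSmall.subset fs ε)).1 (h ε ε.2)

theorem hasIndex_of_gamma_le {f : X → ℝ} (hf : ∃ fs : ℕ → X → ℝ, (∀ n, Continuous (fs n)) ∧
    ∀ x, Tendsto (fun n => fs n x) atTop (𝓝 (f x))) {θ : Ordinal.{0}} (h : gamma f ≤ θ)
    (hθ : θ < ω₁) : ∃ fs : ℕ → X → ℝ, (∀ n, Continuous (fs n)) ∧
    (∀ x, Tendsto (fun n => fs n x) atTop (𝓝 (f x))) ∧
    ∀ ε : ℝ, 0 < ε → HasIndex (SeqSmall fs ε) θ := by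
  obtain ⟨gs, hgs⟩ := hf
  obtain ⟨fs, hfs, hlim, he⟩ := csInf_mem (s := {θ : Ordinal.{0} | ∃ fs : ℕ → X → ℝ,
    (∀ n, Continuous (fs n)) ∧ (∀ x, Tendsto (fun n => fs n x) atTop (𝓝 (f x))) ∧
    θ = ⨆ ε : {ε : ℝ // 0 < ε}, derivRank (seqDeriv fs ε)}) ⟨_, gs, hgs.1, hgs.2, rfl⟩
  refine ⟨fs, hfs, hlim, fun ε hε => ?_⟩
  rw [hasIndex_iff (SeqSmall.subset fs ε)]
  refine iterDeriv_eq_empty_of_derivRank_le (locDeriv_subset _) (le_trans ?_ h) hθ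
  rw [← seqDeriv_eq fs hε]
  change _ ≤ sInf _
  rw [he]
  exact Ordinal.le_iSup (fun ε : {ε : ℝ // 0 < ε} => derivRank (seqDeriv fs ε)) ⟨ε, hε⟩

end Small

/-! ### Baire classes -/

section BaireClass

variable {X Y : Type} [TopologicalSpace X] [TopologicalSpace Y]

theorem isBaireClass_zero_iff {f : X → ℝ} : IsBaireClass 0 f ↔ Continuous f := by
  refine ⟨fun h => ?_, IsBaireClass.continuous f⟩
  generalize hξ : (0 : Ordinal.{0}) = ξ at h
  cases h with
  | continuous _ hf => exact hf
  | limit _ _ ξs fs hξ' => exact absurd (hξ' 0) (hξ ▸ not_lt_zero)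

theorem IsBaireClass.exists_seq {ξ : Ordinal.{0}} {f : X → ℝ} (h : IsBaireClass ξ f)
    (hξ : 0 < ξ) : ∃ (ξs : ℕ → Ordinal.{0}) (fs : ℕ → X → ℝ), (∀ n, ξs n < ξ) ∧
      (∀ n, IsBaireClass (ξs n) (fs n)) ∧ ∀ x, Tendsto (fun n => fs n x) atTop (𝓝 (f x)) := by
  cases h with
  | continuous _ hf => exact absurd hξ (lt_irrefl _)
  | limit _ _ ξs fs h1 h2 h3 => exact ⟨ξs, fs, h1, h2, h3⟩

theorem IsBaireClass.mono {ξ ξ' : Ordinal.{0}} {f : X → ℝ} (h : IsBaireClass ξ f)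
    (hξ : ξ ≤ ξ') : IsBaireClass ξ' f := by
  rcases hξ.eq_or_lt with rfl | hξ
  · exact h
  · exact .limit ξ' f (fun _ => ξ) (fun _ => f) (fun _ => hξ) (fun _ => h)
      fun _ => tendsto_const_nhds

theorem isBaireClass_one_iff {f : X → ℝ} : IsBaireClass 1 f ↔ ∃ fs : ℕ → X → ℝ,
    (∀ n, Continuous (fs n)) ∧ ∀ x, Tendsto (fun n => fs n x) atTop (𝓝 (f x)) := by
  constructor
  · intro h
    obtain ⟨ξs, fs, h1, h2, h3⟩ := h.exists_seq zero_lt_one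
    refine ⟨fs, fun n => ?_, h3⟩
    have := h2 n
    rwa [Order.lt_one_iff.1 (h1 n), isBaireClass_zero_iff] at this
  · rintro ⟨fs, h1, h2⟩
    exact .limit 1 f (fun _ => 0) fs (fun _ => zero_lt_one) (fun n => .continuous _ (h1 n)) h2

theorem IsBaireClass.comp_continuous {ξ : Ordinal.{0}} {f : Y → ℝ} (hf : IsBaireClass ξ f)
    {h : X → Y} (hh : Continuous h) : IsBaireClass ξ (fun x => f (h x)) := by
  induction hf with
  | continuous f hf => exact .continuous _ (hf.comp hh)
  | limit ξ f ξs fs hξ hfs hlim ih => exact .limit ξ _ ξs _ hξ ih fun x => hlim (h x)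

theorem IsBaireClass.map₂ {h : ℝ → ℝ → ℝ} (hh : Continuous (Function.uncurry h))
    {ξ : Ordinal.{0}} {f g : X → ℝ} (hf : IsBaireClass ξ f) (hg : IsBaireClass ξ g) :
    IsBaireClass ξ (fun x => h (f x) (g x)) := by
  induction ξ using WellFoundedLT.induction generalizing f g with
  | ind ξ ih =>
    rcases eq_zero_or_pos ξ with rfl | hξ
    · rw [isBaireClass_zero_iff] at *
      exact hh.comp (hf.prodMk hg)
    · obtain ⟨ξs, fs, h1, h2, h3⟩ := hf.exists_seq hξ
      obtain ⟨ξs', gs, h1', h2', h3'⟩ := hg.exists_seq hξ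
      refine .limit ξ _ (fun n => max (ξs n) (ξs' n)) (fun n x => h (fs n x) (gs n x))
        (fun n => max_lt (h1 n) (h1' n)) (fun n => ih _ (max_lt (h1 n) (h1' n))
          ((h2 n).mono (le_max_left _ _)) ((h2' n).mono (le_max_right _ _))) fun x => ?_
      exact (hh.tendsto (f x, g x)).comp ((h3 x).prodMk_nhds (h3' x))

theorem isBaireClass_const (ξ : Ordinal.{0}) (c : ℝ) : IsBaireClass ξ (fun _ : X => c) :=
  (IsBaireClass.continuous _ continuous_const).mono zero_le

theorem IsBaireClass.add {ξ : Ordinal.{0}} {f g : X → ℝ} (hf : IsBaireClass ξ f)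
    (hg : IsBaireClass ξ g) : IsBaireClass ξ (fun x => f x + g x) :=
  hf.map₂ (h := fun a b => a + b) continuous_add hg

theorem IsBaireClass.mul {ξ : Ordinal.{0}} {f g : X → ℝ} (hf : IsBaireClass ξ f)
    (hg : IsBaireClass ξ g) : IsBaireClass ξ (fun x => f x * g x) :=
  hf.map₂ (h := fun a b => a * b) continuous_mul hg

theorem IsBaireClass.const_sub {ξ : Ordinal.{0}} {f : X → ℝ} (hf : IsBaireClass ξ f) (c : ℝ) :
    IsBaireClass ξ (fun x => c - f x) :=
  (isBaireClass_const ξ c).map₂ (h := fun a b => a - b) continuous_sub hf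

theorem IsBaireClass.of_le {X : Type} {τ τ' : TopologicalSpace X} (hτ : τ' ≤ τ)
    {ξ : Ordinal.{0}} {f : X → ℝ} (hf : @IsBaireClass X τ ξ f) : @IsBaireClass X τ' ξ f :=
  @IsBaireClass.comp_continuous X X τ' τ ξ f hf id (continuous_id_of_le hτ)

/-- `f` is of Baire class less than `ξ`. -/
def IsBaireLT (ξ : Ordinal.{0}) (f : X → ℝ) : Prop := ∃ η < ξ, IsBaireClass η f

theorem isBaireLT_const {ξ : Ordinal.{0}} (hξ : 0 < ξ) (c : ℝ) :
    IsBaireLT ξ (fun _ : X => c) :=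
  ⟨0, hξ, isBaireClass_const 0 c⟩

theorem IsBaireLT.map₂ {h : ℝ → ℝ → ℝ} (hh : Continuous (Function.uncurry h))
    {ξ : Ordinal.{0}} {f g : X → ℝ} (hf : IsBaireLT ξ f) (hg : IsBaireLT ξ g) :
    IsBaireLT ξ (fun x => h (f x) (g x)) := by
  obtain ⟨η, hη, hf⟩ := hf
  obtain ⟨η', hη', hg⟩ := hg
  exact ⟨max η η', max_lt hη hη', (hf.mono (le_max_left _ _)).map₂ hh (hg.mono (le_max_right _ _))⟩

theorem IsBaireLT.mul {ξ : Ordinal.{0}} {f g : X → ℝ} (hf : IsBaireLT ξ f)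
    (hg : IsBaireLT ξ g) : IsBaireLT ξ (fun x => f x * g x) :=
  hf.map₂ (h := fun a b => a * b) continuous_mul hg

theorem IsBaireLT.const_sub {ξ : Ordinal.{0}} {f : X → ℝ} (hf : IsBaireLT ξ f) (c : ℝ) :
    IsBaireLT ξ (fun x => c - f x) :=
  let ⟨η, hη, hf⟩ := hf
  ⟨η, hη, hf.const_sub c⟩

theorem IsBaireLT.sum {ξ : Ordinal.{0}} (hξ : 0 < ξ) {ι : Type*} {f : ι → X → ℝ}
    (hf : ∀ i, IsBaireLT ξ (f i)) (s : Finset ι) : IsBaireLT ξ (fun x => ∑ i ∈ s, f i x) := by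
  classical
  induction s using Finset.induction_on with
  | empty => simpa using isBaireLT_const hξ 0
  | insert i s hi ih =>
    simp only [Finset.sum_insert hi]
    exact (hf i).map₂ (h := fun a b => a + b) continuous_add ih

theorem IsBaireLT.prod {ξ : Ordinal.{0}} (hξ : 0 < ξ) {ι : Type*} {f : ι → X → ℝ}
    (hf : ∀ i, IsBaireLT ξ (f i)) (s : Finset ι) : IsBaireLT ξ (fun x => ∏ i ∈ s, f i x) := by
  classical
  induction s using Finset.induction_on with
  | empty => simpa using isBaireLT_const hξ 1
  | insert i s hi ih =>
    simp only [Finset.prod_insert hi]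
    exact (hf i).mul ih

theorem isBaireClass_of_tendsto {ξ : Ordinal.{0}} {f : X → ℝ} {fs : ℕ → X → ℝ}
    (hfs : ∀ n, IsBaireLT ξ (fs n)) (hlim : ∀ x, Tendsto (fun n => fs n x) atTop (𝓝 (f x))) :
    IsBaireClass ξ f := by
  choose η hη h using hfs
  exact .limit ξ f η fs hη h hlim

end BaireClass

/-! ### The additive Borel classes -/

section Sigma

variable {X Y : Type} [TopologicalSpace X] [TopologicalSpace Y]

theorem IsSigma0.one_le {ξ : Ordinal.{0}} {A : Set X} (h : IsSigma0 ξ A) : 1 ≤ ξ := by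
  cases h with
  | isOpen => exact le_rfl
  | iUnion _ ηs A h1 hξ hA => exact (h1 0).trans (hξ 0).le

theorem isSigma0_one_iff {A : Set X} : IsSigma0 1 A ↔ IsOpen A := by
  refine ⟨fun h => ?_, .isOpen A⟩
  generalize hξ : (1 : Ordinal.{0}) = ξ at h
  cases h with
  | isOpen _ h => exact h
  | iUnion _ ηs A h1 hξ' hA => exact absurd ((h1 0).trans_lt (hξ' 0)) (hξ ▸ lt_irrefl _)

theorem IsSigma0.exists_seq {ξ : Ordinal.{0}} {A : Set X} (h : IsSigma0 ξ A) (hξ : 1 < ξ) :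
    ∃ (ηs : ℕ → Ordinal.{0}) (B : ℕ → Set X), (∀ n, 1 ≤ ηs n) ∧ (∀ n, ηs n < ξ) ∧
      (∀ n, IsSigma0 (ηs n) (B n)ᶜ) ∧ A = ⋃ n, B n := by
  cases h with
  | isOpen => exact absurd hξ (lt_irrefl _)
  | iUnion _ ηs A h1 hξ hA => exact ⟨ηs, A, h1, hξ, hA, rfl⟩

theorem IsSigma0.preimage {ξ : Ordinal.{0}} {A : Set Y} (h : IsSigma0 ξ A) {f : X → Y}
    (hf : Continuous f) : IsSigma0 ξ (f ⁻¹' A) := by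
  induction h with
  | isOpen U hU => exact .isOpen _ (hU.preimage hf)
  | iUnion ξ ηs A h1 hξ hA ih =>
    rw [preimage_iUnion]
    exact .iUnion ξ ηs _ h1 hξ ih

theorem isSigma0_of_compl {ξ η : Ordinal.{0}} {A : Set X} (h : IsSigma0 η Aᶜ) (hη : η < ξ) :
    IsSigma0 ξ A := by
  rw [← iUnion_const (ι := ℕ) A]
  exact .iUnion ξ (fun _ => η) _ (fun _ => h.one_le) (fun _ => hη) fun _ => h

theorem isSigma0_iUnion_of_compl {ξ : Ordinal.{0}} (hξ : 1 < ξ) {ι : Type*} [Countable ι]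
    {η : ι → Ordinal.{0}} {A : ι → Set X} (hη : ∀ i, η i < ξ)
    (hA : ∀ i, IsSigma0 (η i) (A i)ᶜ) : IsSigma0 ξ (⋃ i, A i) := by
  rcases isEmpty_or_nonempty ι with hι | hι
  · rw [iUnion_of_empty]
    exact isSigma0_of_compl (.isOpen _ (by simp)) hξ
  · obtain ⟨e, he⟩ := exists_surjective_nat ι
    rw [← he.iUnion_comp]
    exact .iUnion ξ (fun n => η (e n)) _ (fun n => (hA _).one_le) (fun n => hη _) fun n => hA _

theorem IsSigma0.iUnion_countable {ξ : Ordinal.{0}} (hξ : 1 ≤ ξ) {ι : Type*} [Countable ι]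
    {A : ι → Set X} (hA : ∀ i, IsSigma0 ξ (A i)) : IsSigma0 ξ (⋃ i, A i) := by
  rcases hξ.eq_or_lt with rfl | hξ
  · simp only [isSigma0_one_iff] at *
    exact isOpen_iUnion hA
  · choose η B h1 h2 h3 h4 using fun i => (hA i).exists_seq hξ
    have : ⋃ i, A i = ⋃ p : ι × ℕ, B p.1 p.2 := by
      rw [iUnion_prod']
      exact iUnion_congr h4
    rw [this]
    exact isSigma0_iUnion_of_compl hξ (fun p : ι × ℕ => h2 p.1 p.2) fun p => h3 p.1 p.2

theorem IsSigma0.union {ξ : Ordinal.{0}} {A B : Set X} (hA : IsSigma0 ξ A) (hB : IsSigma0 ξ B) :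
    IsSigma0 ξ (A ∪ B) := by
  rw [union_eq_iUnion]
  exact .iUnion_countable hA.one_le fun b => by cases b <;> assumption

variable [TopologicalSpace.PseudoMetrizableSpace X]

theorem IsSigma0.mono {ξ ξ' : Ordinal.{0}} {A : Set X} (h : IsSigma0 ξ A) (hξ : ξ ≤ ξ') :
    IsSigma0 ξ' A := by
  rcases hξ.eq_or_lt with rfl | hξ
  · exact h
  cases h with
  | isOpen _ hU =>
    let := TopologicalSpace.pseudoMetrizableSpacePseudoMetric X
    obtain ⟨F, hF, -, rfl, -⟩ := hU.exists_iUnion_isClosed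
    exact .iUnion _ (fun _ => 1) F (fun _ => le_rfl) (fun _ => hξ)
      fun n => .isOpen _ (hF n).isOpen_compl
  | iUnion _ ηs A h1 hξ' hA => exact .iUnion _ ηs A h1 (fun n => (hξ' n).trans hξ) hA

theorem IsSigma0.inter {ξ : Ordinal.{0}} {A B : Set X} (hA : IsSigma0 ξ A) (hB : IsSigma0 ξ B) :
    IsSigma0 ξ (A ∩ B) := by
  rcases hA.one_le.eq_or_lt with rfl | hξ
  · simp only [isSigma0_one_iff] at *
    exact hA.inter hB
  obtain ⟨η, C, -, h2, h3, rfl⟩ := hA.exists_seq hξ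
  obtain ⟨η', C', -, h2', h3', rfl⟩ := hB.exists_seq hξ
  have : (⋃ n, C n) ∩ (⋃ n, C' n) = ⋃ p : ℕ × ℕ, C p.1 ∩ C' p.2 := by
    rw [iUnion_prod', iUnion_inter]
    simp only [inter_iUnion]
  rw [this]
  refine isSigma0_iUnion_of_compl hξ (η := fun p : ℕ × ℕ => max (η p.1) (η' p.2))
    (fun p => max_lt (h2 _) (h2' _)) fun p => ?_
  rw [compl_inter]
  exact ((h3 _).mono (le_max_left _ _)).union ((h3' _).mono (le_max_right _ _))

theorem isSigma0_univ {ξ : Ordinal.{0}} (hξ : 1 ≤ ξ) : IsSigma0 ξ (univ : Set X) :=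
  (IsSigma0.isOpen _ isOpen_univ).mono hξ

theorem isSigma0_sInter {ξ : Ordinal.{0}} (hξ : 1 ≤ ξ) {S : Set (Set X)} (hS : S.Finite)
    (h : ∀ A ∈ S, IsSigma0 ξ A) : IsSigma0 ξ (⋂₀ S) := by
  induction S, hS using Set.Finite.induction_on with
  | empty => rw [sInter_empty]; exact isSigma0_univ hξ
  | insert _ _ ih =>
    rw [sInter_insert]
    exact (h _ (mem_insert _ _)).inter (ih fun A hA => h A (mem_insert_of_mem _ hA))

/-- Interiors are needed for limits: a limit in the interior of `F n` forces the sequence into `F n`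
eventually, and closedness of `F n` gives the way back. -/
theorem exists_isClosed_iUnion_interior {U : Set ℝ} (hU : IsOpen U) :
    ∃ F : ℕ → Set ℝ, (∀ n, IsClosed (F n)) ∧ (∀ n, F n ⊆ U) ∧ U ⊆ ⋃ n, interior (F n) := by
  refine ⟨fun n => {y | (n : ℝ≥0∞)⁻¹ ≤ Metric.infEDist y Uᶜ}, fun n => ?_, fun n y hy => ?_,
    fun y hy => ?_⟩
  · exact isClosed_le continuous_const Metric.continuous_infEDist
  · by_contra hyU
    have h0 : Metric.infEDist y Uᶜ = 0 := Metric.infEDist_zero_of_mem hyU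
    have : (n : ℝ≥0∞)⁻¹ ≤ 0 := h0 ▸ hy
    simp at this
  · have h0 : Metric.infEDist y Uᶜ ≠ 0 := fun h0 =>
      (hU.isClosed_compl.closure_eq ▸ Metric.mem_closure_iff_infEDist_zero.2 h0 : y ∈ Uᶜ) hy
    obtain ⟨n, hn⟩ := ENNReal.exists_inv_nat_lt h0
    refine mem_iUnion.2 ⟨n, mem_interior.2 ⟨{y | (n : ℝ≥0∞)⁻¹ < Metric.infEDist y Uᶜ}, ?_, ?_, hn⟩⟩
    · intro z hz
      exact le_of_lt (show (n : ℝ≥0∞)⁻¹ < Metric.infEDist z Uᶜ from hz)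
    · exact isOpen_lt continuous_const Metric.continuous_infEDist

/-- The limit lies in `U` iff, for some `m`, almost all terms lie in the closed set `F m`. By
induction each such condition on a tail is `Π⁰_ξ`, and countably many of them are united. -/
theorem IsBaireClass.isSigma0_preimage {ξ : Ordinal.{0}} {f : X → ℝ} (hf : IsBaireClass ξ f)
    {U : Set ℝ} (hU : IsOpen U) : IsSigma0 (ξ + 1) (f ⁻¹' U) := by
  induction hf generalizing U with
  | continuous f hf =>
    rw [zero_add]
    exact .isOpen _ (hU.preimage hf)
  | limit ξ f ξs fs hξ hfs hlim ih =>
    obtain ⟨F, hF, hFU, hUF⟩ := exists_isClosed_iUnion_interior hU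
    have hξ1 : 1 ≤ ξ := Order.one_le_iff_pos.2 (zero_le.trans_lt (hξ 0))
    have : f ⁻¹' U = ⋃ p : ℕ × ℕ, ⋂ n : Ici p.2, fs n ⁻¹' F p.1 := by
      ext x
      simp only [mem_preimage, mem_iUnion, mem_iInter, Prod.exists, Subtype.forall, mem_Ici]
      constructor
      · intro hx
        obtain ⟨m, hm⟩ := mem_iUnion.1 (hUF hx)
        obtain ⟨N, hN⟩ := eventually_atTop.1
          ((hlim x).eventually (mem_interior_iff_mem_nhds.1 hm))
        exact ⟨m, N, hN⟩
      · rintro ⟨m, N, h⟩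
        exact hFU m ((hF m).mem_of_tendsto (hlim x) (eventually_atTop.2 ⟨N, h⟩))
    rw [this]
    refine isSigma0_iUnion_of_compl (η := fun _ => ξ) (Order.lt_add_one_iff.2 hξ1)
      (fun _ => Order.lt_add_one_iff.2 le_rfl) fun p => ?_
    rw [compl_iInter]
    refine .iUnion_countable hξ1 fun n => ?_
    exact (ih n (hF p.1).isOpen_compl).mono (Order.add_one_le_of_lt (hξ n))

/-- Reaching the value `1` exactly, and not only in the limit, lets products and sums of these
approximations be evaluated at finite stages. -/
theorem IsSigma0.exists_approx {ξ : Ordinal.{0}} {V : Set X} (hV : IsSigma0 ξ V) :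
    ∃ g : ℕ → X → ℝ, (∀ k, IsBaireLT ξ (g k)) ∧ (∀ k, ∀ x ∉ V, g k x = 0) ∧
      ∀ x ∈ V, ∀ᶠ k in atTop, g k x = 1 := by
  induction hV with
  | isOpen U hU =>
    let := TopologicalSpace.pseudoMetrizableSpacePseudoMetric X
    obtain ⟨F, hF, hFU, hU', hmono⟩ := hU.exists_iUnion_isClosed
    choose g h0 h1 _ using fun n => exists_continuous_zero_one_of_isClosed hU.isClosed_compl (hF n)
      (disjoint_compl_left_iff_subset.2 (hFU n))
    refine ⟨fun n => g n, fun n => ⟨0, zero_lt_one, .continuous _ (g n).continuous⟩,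
      fun n x hx => h0 n hx, fun x hx => ?_⟩
    obtain ⟨n, hn⟩ := mem_iUnion.1 (hU' ▸ hx)
    exact eventually_atTop.2 ⟨n, fun k hk => h1 k (hmono hk hn)⟩
  | iUnion ξ ηs A hη1 hξ hA ih =>
    choose g h0 h1 h2 using ih
    have hpos : 0 < ξ := zero_le.trans_lt (hξ 0)
    have key : ∀ n, IsBaireLT ξ ((A n)ᶜ.indicator fun _ => (1 : ℝ)) := by
      intro n
      refine ⟨ηs n, hξ n, isBaireClass_of_tendsto (h0 n) fun x => ?_⟩
      by_cases hx : x ∈ (A n)ᶜ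
      · rw [indicator_of_mem hx]
        exact tendsto_const_nhds.congr' ((h2 n x hx).mono fun k hk => hk.symm)
      · rw [indicator_of_notMem hx]
        simp only [h1 n _ x hx, tendsto_const_nhds_iff]
    -- This is the characteristic function of the union of the first `k` sets.
    refine ⟨fun k x => 1 - ∏ n ∈ Finset.range k, (A n)ᶜ.indicator (fun _ => (1 : ℝ)) x,
      fun k => (IsBaireLT.prod hpos key _).const_sub 1, fun k x hx => ?_, fun x hx => ?_⟩
    · dsimp only
      rw [Finset.prod_eq_one, sub_self]
      intro n _
      exact indicator_of_mem (s := (A n)ᶜ) (fun h => hx (mem_iUnion.2 ⟨n, h⟩)) _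
    · obtain ⟨n, hn⟩ := mem_iUnion.1 hx
      refine eventually_atTop.2 ⟨n + 1, fun k hk => ?_⟩
      dsimp only
      rw [Finset.prod_eq_zero (Finset.mem_range.2 hk), sub_zero]
      exact indicator_of_notMem (s := (A n)ᶜ) (fun h => h hn) _

end Sigma

/-! ### Polish refinements -/

section Refinement

variable {X : Type} [τ : TopologicalSpace X]

/-- `τ'` is a Polish topology finer than the given one and consisting of `Σ⁰_ξ` sets. -/
def IsRefinement (ξ : Ordinal.{0}) (τ' : TopologicalSpace X) : Prop :=
  τ' ≤ τ ∧ @PolishSpace X τ' ∧ ∀ U : Set X, IsOpen[τ'] U → @IsSigma0 X τ ξ U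

theorem isSigma0_of_isOpen_generateFrom [TopologicalSpace.PseudoMetrizableSpace X]
    {ξ : Ordinal.{0}} (hξ : 1 ≤ ξ) {G : Set (Set X)} {τ' : TopologicalSpace X}
    (hG : τ' = TopologicalSpace.generateFrom G) (hτ' : @SecondCountableTopology X τ')
    (h : ∀ A ∈ G, @IsSigma0 X τ ξ A) {U : Set X} (hU : IsOpen[τ'] U) :
    @IsSigma0 X τ ξ U := by
  have hB := @TopologicalSpace.isTopologicalBasis_of_subbasis X τ' G hG
  obtain ⟨S, hS, rfl⟩ := @TopologicalSpace.IsTopologicalBasis.open_eq_sUnion X τ' _ hB U hU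
  obtain ⟨T, hTc, hTS, hT⟩ := @TopologicalSpace.isOpen_sUnion_countable X τ' hτ' S
    fun s hs => @TopologicalSpace.IsTopologicalBasis.isOpen X τ' _ _ hB (hS hs)
  rw [← hT, sUnion_eq_iUnion]
  have := hTc.to_subtype
  refine @IsSigma0.iUnion_countable X τ ξ hξ _ _ _ fun s => ?_
  obtain ⟨F, ⟨hF, hFG⟩, hs⟩ := hS (hTS s.2)
  rw [← hs]
  exact @isSigma0_sInter X τ _ ξ hξ _ hF fun A hA => h A (hFG hA)

theorem exists_isRefinement_forall_le [PolishSpace X] {ξ : Ordinal.{0}} (hξ : 1 ≤ ξ)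
    {ι : Type*} [Countable ι] {t : ι → TopologicalSpace X} (ht : ∀ i, IsRefinement ξ (t i)) :
    ∃ τ', IsRefinement ξ τ' ∧ ∀ i, τ' ≤ t i := by
  -- Adding `τ` itself to the family provides a member coarser than all the others, and covers an
  -- empty `ι`.
  let m : Option ι → TopologicalSpace X := fun i => i.elim τ t
  have hm : ∀ i, IsRefinement ξ (m i) := by
    rintro (_ | i)
    · exact ⟨le_rfl, ‹PolishSpace X›, fun U hU => (@IsSigma0.isOpen X τ U hU).mono hξ⟩
    · exact ht i
  have hP : @PolishSpace X (⨅ i, m i) :=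
    PolishSpace.iInf ⟨none, fun i => (hm i).1⟩ fun i => (hm i).2.1
  refine ⟨⨅ i, m i, ⟨iInf_le m none, hP, fun U hU => ?_⟩, fun i => iInf_le m (some i)⟩
  refine isSigma0_of_isOpen_generateFrom hξ (generateFrom_iUnion_isOpen m).symm
    hP.toSecondCountableTopology (fun A hA => ?_) hU
  obtain ⟨i, hi⟩ := mem_iUnion.1 hA
  exact (hm i).2.2 A hi

/-- Retopologize `X` as the disjoint sum of `s` and its complement, both Polish. The explicit form
of the new open sets is what controls their Borel class. -/
theorem exists_polish_isOpen_of_isClosed [PolishSpace X] {s : Set X} (hs : IsClosed s) :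
    ∃ τ' ≤ τ, @PolishSpace X τ' ∧ IsOpen[τ'] s ∧
      ∀ U, IsOpen[τ'] U → ∃ V W, IsOpen V ∧ IsOpen W ∧ U = V ∪ (W ∩ s) := by
  classical
  have : PolishSpace s := hs.polishSpace
  let t : Set X := sᶜ
  have : PolishSpace t := hs.isOpen_compl.polishSpace
  let f : s ⊕ t ≃ X := Equiv.Set.sumCompl s
  have hle : TopologicalSpace.coinduced f instTopologicalSpaceSum ≤ τ := by
    simp only [instTopologicalSpaceSum, coinduced_sup, coinduced_compose, sup_le_iff,
      ← continuous_iff_coinduced_le]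
    exact ⟨continuous_subtype_val, continuous_subtype_val⟩
  refine ⟨.coinduced f instTopologicalSpaceSum, hle, ?_, ?_, fun U hU => ?_⟩
  · rw [← f.induced_symm]
    exact f.symm.polishSpace_induced
  · rw [isOpen_coinduced, isOpen_sum_iff]
    simp [preimage_preimage, f, t]
  · rw [isOpen_coinduced, isOpen_sum_iff] at hU
    obtain ⟨⟨W, hW, hWU⟩, ⟨V, hV, hVU⟩⟩ := hU.imp isOpen_induced_iff.1 isOpen_induced_iff.1
    refine ⟨V ∩ sᶜ, W, hV.inter hs.isOpen_compl, hW, ?_⟩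
    ext x
    by_cases hx : x ∈ s
    · have := Set.ext_iff.1 hWU ⟨x, hx⟩
      have hfx : f (Sum.inl ⟨x, hx⟩) = x := rfl
      simp only [mem_preimage, hfx] at this
      simpa [hx] using this.symm
    · have := Set.ext_iff.1 hVU ⟨x, hx⟩
      have hfx : f (Sum.inr ⟨x, hx⟩) = x := rfl
      simp only [mem_preimage, hfx] at this
      simpa [hx] using this.symm

/-- By induction the complement of each `A n` can be made open, so `A n` closed; one further
refinement makes `A n` open. The new open sets are built from `Σ⁰_(ηs n)` sets and the `Π⁰_(ηs n)`
set `A n`, hence stay in `Σ⁰_ξ`. -/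
theorem IsSigma0.exists_isRefinement [PolishSpace X] {ξ : Ordinal.{0}} {S : Set X}
    (hS : IsSigma0 ξ S) : ∃ τ', IsRefinement ξ τ' ∧ IsOpen[τ'] S := by
  induction hS with
  | isOpen U hU => exact ⟨τ, ⟨le_rfl, ‹_›, fun U hU => .isOpen U hU⟩, hU⟩
  | iUnion ξ ηs A h1 hξ hA ih =>
    have key : ∀ n, ∃ τ', IsRefinement ξ τ' ∧ IsOpen[τ'] (A n) := by
      intro n
      obtain ⟨τ₁, ⟨hle, hP, hτ₁⟩, hAn⟩ := ih n
      obtain ⟨τ₂, hle₂, hP₂, ho, h⟩ := @exists_polish_isOpen_of_isClosed X τ₁ hP (A n)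
        (@isOpen_compl_iff X _ τ₁ |>.1 hAn)
      refine ⟨τ₂, ⟨hle₂.trans hle, hP₂, fun U hU => ?_⟩, ho⟩
      obtain ⟨V, W, hV, hW, rfl⟩ := h U hU
      exact @IsSigma0.union X τ _ _ _ (@IsSigma0.mono X τ _ _ _ _ (hτ₁ V hV) (hξ n).le)
        (@IsSigma0.inter X τ _ _ _ _ (@IsSigma0.mono X τ _ _ _ _ (hτ₁ W hW) (hξ n).le)
          (@isSigma0_of_compl X τ _ _ _ (hA n) (hξ n)))
    choose t ht ho using key
    obtain ⟨τ', hτ', hle⟩ := exists_isRefinement_forall_le ((h1 0).trans (hξ 0).le) ht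
    exact ⟨τ', hτ', isOpen_iUnion fun n => hle n _ (ho n)⟩

theorem refinements_nonempty [PolishSpace X] {ξ : Ordinal.{0}} (hξ : 1 ≤ ξ) {f : X → ℝ}
    (hf : IsBaireClass ξ f) : (refinements ξ f).Nonempty := by
  obtain ⟨ξs, fs, h1, h2, h3⟩ := hf.exists_seq (zero_lt_one.trans_le hξ)
  let B := TopologicalSpace.countableBasis ℝ
  have hB := TopologicalSpace.isBasis_countableBasis ℝ
  have : Countable B := (TopologicalSpace.countable_countableBasis ℝ).to_subtype
  have key : ∀ p : ℕ × B, ∃ τ', IsRefinement ξ τ' ∧ IsOpen[τ'] (fs p.1 ⁻¹' p.2) := fun p =>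
    (((h2 p.1).isSigma0_preimage (hB.isOpen p.2.2)).mono
      (Order.add_one_le_of_lt (h1 p.1))).exists_isRefinement
  choose t ht ho using key
  obtain ⟨τ', ⟨hle, hP, hS⟩, hτ'⟩ := exists_isRefinement_forall_le hξ ht
  refine ⟨τ', hle, hP, hS, ?_⟩
  rw [@isBaireClass_one_iff X τ']
  refine ⟨fs, fun n => ?_, h3⟩
  exact (@TopologicalSpace.IsTopologicalBasis.continuous_iff X ℝ τ' _ _ hB _).2
    fun s hs => hτ' (n, ⟨s, hs⟩) _ (ho (n, ⟨s, hs⟩))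

end Refinement

/-! ### Universal sets -/

section Universal

theorem countable_Iio_of_lt_omega_one {ξ : Ordinal.{0}} (hξ : ξ < ω₁) : Countable (Iio ξ) := by
  rw [← Cardinal.mk_le_aleph0_iff, Cardinal.mk_Iio_ordinal, Cardinal.lift_le_aleph0,
    ← Order.lt_succ_iff, Cardinal.succ_aleph0, ← Cardinal.lt_ord, Cardinal.ord_aleph]
  exact hξ

/-- The `n`-th column of a point of the Cantor space, regarded as a sequence of points. -/
def column (n : ℕ) (y : ℕ → Bool) : ℕ → Bool := fun m => y (Nat.pair n m)

theorem continuous_column (n : ℕ) : Continuous (column n) :=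
  continuous_pi fun m => continuous_apply (Nat.pair n m)

theorem exists_column_eq {ι : Type*} {e : ι → ℕ} (he : Function.Injective e)
    (c : ι → ℕ → Bool) : ∃ y, ∀ i, column (e i) y = c i := by
  refine ⟨fun k => Function.extend e c (fun _ _ => true) (Nat.unpair k).1 (Nat.unpair k).2,
    fun i => ?_⟩
  funext m
  simp [column, he.extend_apply]

variable {X : Type} [TopologicalSpace X] [TopologicalSpace.PseudoMetrizableSpace X]

/-- A code for a union stores in its columns the codes of the complements of the pieces. One column
is kept for every class below `ξ` and every `n`, which is possible because `ξ` is countable. -/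
theorem exists_universal_isSigma0 [SecondCountableTopology X] {ξ : Ordinal.{0}} (h1 : 1 ≤ ξ)
    (hξ : ξ < ω₁) : ∃ U : Set ((ℕ → Bool) × X), IsSigma0 ξ U ∧
      ∀ A : Set X, IsSigma0 ξ A → ∃ y, ∀ x, (y, x) ∈ U ↔ x ∈ A := by
  classical
  induction ξ using WellFoundedLT.induction with
  | ind ξ ih =>
  rcases h1.eq_or_lt with rfl | h1
  · let B := TopologicalSpace.countableBasis X
    have hB := TopologicalSpace.isBasis_countableBasis X
    have : Countable B := (TopologicalSpace.countable_countableBasis X).to_subtype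
    obtain ⟨e, he⟩ := Countable.exists_injective_nat B
    refine ⟨⋃ b : B, {p | p.1 (e b) = true ∧ p.2 ∈ b.1}, .isOpen _ (isOpen_iUnion fun b => ?_),
      fun A hA => ⟨fun n => decide (∃ b : B, e b = n ∧ b.1 ⊆ A), fun x => ?_⟩⟩
    · have hc : Continuous fun p : (ℕ → Bool) × X => p.1 (e b) :=
        (continuous_apply _).comp continuous_fst
      exact ((isOpen_discrete {true}).preimage hc).inter
        ((hB.isOpen b.2).preimage continuous_snd)
    · rw [isSigma0_one_iff] at hA
      simp only [mem_iUnion]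
      constructor
      · rintro ⟨b, hb, hxb⟩
        obtain ⟨b', hb', hA'⟩ := of_decide_eq_true hb
        exact hA' (he hb' ▸ hxb)
      · intro hx
        obtain ⟨b, hb, hxb, hbA⟩ := hB.exists_subset_of_mem_open hx hA
        exact ⟨⟨b, hb⟩, decide_eq_true ⟨⟨b, hb⟩, rfl, hbA⟩, hxb⟩
  · let I := {η : Iio ξ // 1 ≤ η.1}
    have : Countable (Iio ξ) := countable_Iio_of_lt_omega_one hξ
    choose U hU hsec using fun i : I => ih i.1.1 i.1.2 i.2 ((show i.1.1 < ξ from i.1.2).trans hξ)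
    obtain ⟨e, he⟩ := Countable.exists_injective_nat (I × ℕ)
    refine ⟨⋃ p : I × ℕ, {q | (column (e p) q.1, q.2) ∉ U p.1},
      isSigma0_iUnion_of_compl h1 (η := fun p => p.1.1.1) (fun p => p.1.1.2) fun p => ?_,
      fun A hA => ?_⟩
    · have hc : Continuous fun q : (ℕ → Bool) × X => (column (e p) q.1, q.2) :=
        ((continuous_column _).comp continuous_fst).prodMk continuous_snd
      have := (hU p.1).preimage hc
      convert this using 1
      ext q
      simp
    · obtain ⟨ηs, B, hη1, hηξ, hB, rfl⟩ := hA.exists_seq h1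
      -- A column whose class is not that of the piece codes the whole space, so it contributes the
      -- empty set to the union.
      have key : ∀ p : I × ℕ, ∃ y, ∀ x, (y, x) ∈ U p.1 ↔ (p.1.1.1 = ηs p.2 → x ∉ B p.2) := by
        intro p
        by_cases hp : p.1.1.1 = ηs p.2
        · obtain ⟨y, hy⟩ := hsec p.1 _ (hp ▸ hB p.2)
          exact ⟨y, fun x => by simp [hy, hp]⟩
        · obtain ⟨y, hy⟩ := hsec p.1 _ (isSigma0_univ p.1.2)
          exact ⟨y, fun x => by simp [hy, hp]⟩
      choose c hc using key
      obtain ⟨y, hy⟩ := exists_column_eq he c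
      refine ⟨y, fun x => ?_⟩
      simp only [mem_iUnion]
      constructor
      · rintro ⟨p, hp⟩
        have hp : (column (e p) y, x) ∉ U p.1 := hp
        rw [hy, hc] at hp
        push Not at hp
        exact ⟨p.2, hp.2⟩
      · rintro ⟨n, hn⟩
        refine ⟨(⟨⟨ηs n, hηξ n⟩, hη1 n⟩, n), ?_⟩
        change (column _ y, x) ∉ U _
        rw [hy, hc]
        push Not
        exact ⟨rfl, hn⟩

end Universal

/-! ### Well-ordered separation and diagonalization -/

section Diagonal

/-- The set of points that belong to some `W i` but not to `V i` nor to any earlier `V j`, `W j`. -/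
def firstDiff {X : Type} {I : Type*} [LT I] (V W : I → Set X) : Set X :=
  {x | ∃ i, x ∈ W i ∧ x ∉ V i ∧ ∀ j < i, x ∉ V j ∧ x ∉ W j}

variable {I : Type*} [LinearOrder I] [WellFoundedLT I]

/-- Only the first index `i` with `x ∈ V i ∪ W i` matters at `x`. Terms of earlier indices vanish,
since `x` is in neither set; terms of later ones vanish as soon as the factor of `i` in their
product is exactly `0`. Hence the finite sums are eventually constant at each point, whatever the
order type of `I`. -/
theorem isBaireClass_indicator_firstDiff [Countable I] {X : Type} [TopologicalSpace X]
    [TopologicalSpace.PseudoMetrizableSpace X] {ξ : Ordinal.{0}} (hξ : 1 ≤ ξ) {V W : I → Set X}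
    (hV : ∀ i, IsSigma0 ξ (V i)) (hW : ∀ i, IsSigma0 ξ (W i)) :
    IsBaireClass ξ ((firstDiff V W).indicator fun _ => (1 : ℝ)) := by
  classical
  have hpos : 0 < ξ := zero_lt_one.trans_le hξ
  choose g hg hg0 hg1 using fun i => (hV i).exists_approx
  choose h hh hh0 hh1 using fun i => (hW i).exists_approx
  obtain ⟨e, he⟩ := Countable.exists_injective_nat I
  let S : ℕ → Finset I := fun k => (Finset.range k).preimage e he.injOn
  refine isBaireClass_of_tendsto (fs := fun k x => ∑ i ∈ S k, h i k x * (1 - g i k x) *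
    ∏ j ∈ (S k).filter (· < i), ((1 - g j k x) * (1 - h j k x))) (fun k => ?_) fun x => ?_
  · exact .sum hpos (fun i => ((hh i k).mul ((hg i k).const_sub 1)).mul (.prod hpos
      (fun j => ((hg j k).const_sub 1).mul ((hh j k).const_sub 1)) _)) _
  refine tendsto_const_nhds.congr' ?_
  by_cases hx : ∃ i, x ∈ V i ∪ W i
  · obtain ⟨i, hi, hmin⟩ := WellFounded.has_min (wellFounded_lt (α := I)) {i | x ∈ V i ∪ W i} hx
    have hmin' : ∀ j < i, x ∉ V j ∧ x ∉ W j := fun j hj =>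
      not_or.1 fun hx => hmin j hx hj
    have hgi : ∀ᶠ k in atTop, g i k x = (V i).indicator (fun _ => (1 : ℝ)) x := by
      by_cases hxV : x ∈ V i
      · simpa only [indicator_of_mem hxV] using hg1 i x hxV
      · exact .of_forall fun k => by rw [indicator_of_notMem hxV, hg0 i k x hxV]
    have hhi : ∀ᶠ k in atTop, h i k x = (W i).indicator (fun _ => (1 : ℝ)) x := by
      by_cases hxW : x ∈ W i
      · simpa only [indicator_of_mem hxW] using hh1 i x hxW
      · exact .of_forall fun k => by rw [indicator_of_notMem hxW, hh0 i k x hxW]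
    filter_upwards [hgi, hhi, eventually_gt_atTop (e i)] with k hgk hhk hk
    have hiS : i ∈ S k := by simpa [S] using hk
    rw [Finset.sum_eq_single i, Finset.prod_eq_one, hgk, hhk, mul_one]
    · by_cases hxA : x ∈ firstDiff V W
      · rw [indicator_of_mem hxA]
        obtain ⟨i', h1, h2, h3⟩ := hxA
        have : i' = i := by
          rcases lt_trichotomy i i' with hlt | heq | hlt
          · exact absurd hi (not_or.2 (h3 i hlt))
          · exact heq.symm
          · exact absurd h1 (hmin' _ hlt).2
        subst this
        simp [h1, h2]
      · rw [indicator_of_notMem hxA]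
        by_cases hxV : x ∈ V i
        · simp [hxV]
        · by_cases hxW : x ∈ W i
          · exact absurd ⟨i, hxW, hxV, hmin'⟩ hxA
          · simp [hxW]
    · intro j hj
      obtain ⟨h1, h2⟩ := hmin' j (Finset.mem_filter.1 hj).2
      rw [hg0 j k x h1, hh0 j k x h2]
      norm_num
    · intro j _ hne
      rcases lt_or_gt_of_ne hne with hlt | hlt
      · rw [hh0 j k x (hmin' j hlt).2, zero_mul, zero_mul]
      · rw [Finset.prod_eq_zero (Finset.mem_filter.2 ⟨hiS, hlt⟩), mul_zero]
        rw [hgk, hhk]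
        rcases hi with hi | hi
        · rw [indicator_of_mem hi, sub_self, zero_mul]
        · rw [indicator_of_mem hi, sub_self, mul_zero]
    · exact fun hn => absurd hiS hn
  · push Not at hx
    refine .of_forall fun k => ?_
    have hxA : x ∉ firstDiff V W := fun ⟨i, hi, _⟩ => hx i (Or.inr hi)
    rw [indicator_of_notMem hxA]
    refine (Finset.sum_eq_zero fun i _ => ?_).symm
    rw [hh0 i k x fun h => hx i (Or.inr h), zero_mul, zero_mul]

/-- The image of an open set need not be open, but that of a closed set is compact. The set in
question is the image of `S` together with everything outside the range of `φ`, and this form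
survives the induction. -/
theorem IsSigma0.compl_image_compl {X Y : Type} [TopologicalSpace X] [CompactSpace X]
    [TopologicalSpace Y] [T2Space Y] [TopologicalSpace.PseudoMetrizableSpace Y] {φ : X → Y}
    (hφ : Continuous φ) (hinj : Function.Injective φ) {ξ : Ordinal.{0}} {S : Set X}
    (hS : IsSigma0 ξ S) : IsSigma0 ξ (φ '' Sᶜ)ᶜ := by
  induction hS with
  | isOpen U hU =>
    exact .isOpen _ ((hU.isClosed_compl.isCompact.image hφ).isClosed.isOpen_compl)
  | iUnion ξ ηs A h1 hξ hA ih =>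
    have h1ξ : 1 ≤ ξ := (h1 0).trans (hξ 0).le
    have : (φ '' (⋃ n, A n)ᶜ)ᶜ = (⋃ n, φ '' A n) ∪ (range φ)ᶜ := by
      ext y
      by_cases hy : y ∈ range φ
      · obtain ⟨x, rfl⟩ := hy
        simp [hinj.eq_iff]
      · have : ∀ T : Set X, y ∉ φ '' T := fun T h => hy (image_subset_range _ _ h)
        simp [hy, this]
    rw [this]
    refine (IsSigma0.iUnion_countable h1ξ fun n => ?_).union
      ((IsSigma0.isOpen _ (isCompact_range hφ).isClosed.isOpen_compl).mono h1ξ)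
    refine isSigma0_of_compl ?_ (hξ n)
    have := ih n
    rwa [compl_compl] at this

/-- On the Cantor set, the sets `Q (i, false)` and `Q (i, true)` contain `φ y` iff the sets coded by
the matching columns of `y` do. `firstDiff` puts `φ y` in `A` when the first relevant index has it
in `W` only, whereas separation demands `V` only. -/
theorem exists_indicator_not_separated [Countable I] {ξ : Ordinal.{0}} (h1 : 1 ≤ ξ)
    (hξ : ξ < ω₁) {P : Set ℝ} (hP : Perfect P) (hne : P.Nonempty) :
    ∃ A ⊆ P, IsBaireClass ξ (A.indicator fun _ => (1 : ℝ)) ∧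
      ¬ ∃ V W : I → Set ℝ, (∀ i, IsSigma0 ξ (V i)) ∧ (∀ i, IsSigma0 ξ (W i)) ∧
        ∀ x, ∃ i, (∀ j < i, x ∉ V j ∧ x ∉ W j) ∧
          (x ∈ A → x ∈ V i ∧ x ∉ W i) ∧ (x ∉ A → x ∈ W i ∧ x ∉ V i) := by
  obtain ⟨φ, hφP, hφ, hinj⟩ := hP.exists_nat_bool_injection hne
  obtain ⟨U, hU, huniv⟩ := exists_universal_isSigma0 (X := ℝ) h1 hξ
  obtain ⟨e, he⟩ := Countable.exists_injective_nat (I × Bool)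
  let T : I × Bool → Set (ℕ → Bool) := fun p => {y | (column (e p) y, φ y) ∈ U}
  have hT : ∀ p, IsSigma0 ξ (T p) := fun p =>
    hU.preimage (f := fun y => (column (e p) y, φ y)) ((continuous_column _).prodMk hφ)
  let Q : I × Bool → Set ℝ := fun p => (φ '' (T p)ᶜ)ᶜ
  have hQ : ∀ p, IsSigma0 ξ (Q p) := fun p => (hT p).compl_image_compl hφ hinj
  have memQ : ∀ p y, φ y ∈ Q p ↔ (column (e p) y, φ y) ∈ U := by
    intro p y
    simp only [Q, mem_compl_iff, hinj.mem_set_image, not_not]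
    rfl
  refine ⟨firstDiff (fun i => Q (i, false)) (fun i => Q (i, true)), ?_,
    isBaireClass_indicator_firstDiff h1 (fun i => hQ _) (fun i => hQ _), ?_⟩
  -- Every `Q p` contains all points off the range of `φ`, so missing `Q (i, false)` puts `x` in
  -- that range.
  · rintro x ⟨i, -, hx, -⟩
    exact hφP (image_subset_range _ _ (not_not.1 hx))
  · rintro ⟨V, W, hV, hW, H⟩
    choose c hc using fun p : I × Bool => huniv (if p.2 then W p.1 else V p.1)
      (by split_ifs; exacts [hW _, hV _])
    -- The point `y` codes the whole assumed separating family; the contradiction occurs at `φ y`.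
    obtain ⟨y, hy⟩ := exists_column_eq he c
    have hVQ : ∀ i, φ y ∈ Q (i, false) ↔ φ y ∈ V i := fun i => by
      rw [memQ, hy, hc]; simp
    have hWQ : ∀ i, φ y ∈ Q (i, true) ↔ φ y ∈ W i := fun i => by
      rw [memQ, hy, hc]; simp
    obtain ⟨i, hi, hin, hout⟩ := H (φ y)
    by_cases hyA : φ y ∈ firstDiff (fun i => Q (i, false)) (fun i => Q (i, true))
    · have hVi := hin hyA
      obtain ⟨i', hi'W, hi'V, hi'⟩ := hyA
      simp only [hVQ, hWQ] at hi'W hi'V hi'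
      rcases lt_trichotomy i i' with hlt | rfl | hlt
      · exact (hi' i hlt).1 hVi.1
      · exact hi'V hVi.1
      · exact (hi i' hlt).2 hi'W
    · refine hyA ⟨i, (hWQ i).2 (hout hyA).1, fun h => (hout hyA).2 ((hVQ i).1 h), fun j hj => ?_⟩
      exact ⟨fun h => (hi j hj).1 ((hVQ j).1 h), fun h => (hi j hj).2 ((hWQ j).1 h)⟩

/-- A characteristic function that oscillates by less than `1` on a set is constant there, so each
level of the index is locally inside `A` or inside its complement. The unions of the corresponding
open sets are `Σ⁰_ξ` because `τ'` is, and they separate `A`. -/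
theorem exists_isBaireClass_not_hasIndex {ξ : Ordinal.{0}} (h1 : 1 ≤ ξ) (hξ : ξ < ω₁)
    {P : Set ℝ} (hP : Perfect P) (hne : P.Nonempty) {ζ : Ordinal.{0}} (hζ : ζ < ω₁) :
    ∃ f : ℝ → ℝ, IsBaireClass ξ f ∧ (∀ x ∉ P, f x = 0) ∧
      ∀ τ' ∈ refinements ξ f, ¬ @HasIndex ℝ τ' (OscSmall f 1) ζ := by
  have : Countable (Iio ζ) := countable_Iio_of_lt_omega_one hζ
  obtain ⟨A, hAP, hA, hsep⟩ := exists_indicator_not_separated (I := Iio ζ) h1 hξ hP hne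
  refine ⟨_, hA, fun x hx => indicator_of_notMem (fun h => hx (hAP h)) _, ?_⟩
  rintro τ' ⟨-, -, hτ', -⟩ ⟨r, hr, h⟩
  refine hsep ⟨fun i => ⋃₀ {U | IsOpen[τ'] U ∧ ∀ y ∈ U, r y ≤ i ∧ (r y = i → y ∈ A)},
    fun i => ⋃₀ {U | IsOpen[τ'] U ∧ ∀ y ∈ U, r y ≤ i ∧ (r y = i → y ∉ A)},
    fun i => hτ' _ (@isOpen_sUnion _ τ' _ fun U hU => hU.1),
    fun i => hτ' _ (@isOpen_sUnion _ τ' _ fun U hU => hU.1), fun x => ?_⟩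
  refine ⟨⟨r x, hr x⟩, fun j hj => ⟨?_, ?_⟩, fun hx => ⟨?_, ?_⟩, fun hx => ⟨?_, ?_⟩⟩
  · rintro ⟨U, hU, hxU⟩
    exact (hU.2 x hxU).1.not_gt hj
  · rintro ⟨U, hU, hxU⟩
    exact (hU.2 x hxU).1.not_gt hj
  · obtain ⟨U, hU, hxU, hle, δ, hδ, hs⟩ := h x
    refine ⟨U, ⟨hU, fun y hy => ⟨hle y hy, fun hyr => ?_⟩⟩, hxU⟩
    by_contra hyA
    have := hs y ⟨hy, hyr⟩ x ⟨hxU, rfl⟩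
    rw [indicator_of_mem hx, indicator_of_notMem hyA] at this
    norm_num at this
    linarith
  · rintro ⟨U, hU, hxU⟩
    exact (hU.2 x hxU).2 rfl hx
  · obtain ⟨U, hU, hxU, hle, δ, hδ, hs⟩ := h x
    refine ⟨U, ⟨hU, fun y hy => ⟨hle y hy, fun hyr hyA => ?_⟩⟩, hxU⟩
    have := hs y ⟨hy, hyr⟩ x ⟨hxU, rfl⟩
    rw [indicator_of_mem hyA, indicator_of_notMem hx] at this
    norm_num at this
    linarith
  · rintro ⟨U, hU, hxU⟩
    exact hx ((hU.2 x hxU).2 rfl)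

end Diagonal

/-! ### Multiplication by the characteristic function of a closed set -/

section Indicator

variable {X : Type} [TopologicalSpace X]

/-- Locally uniform vanishing off `F`, stronger than pointwise convergence, makes the tails of a
product sequence small near every point outside `F`. -/
theorem exists_continuous_approx_indicator [TopologicalSpace.PseudoMetrizableSpace X] {F : Set X}
    (hF : IsClosed F) : ∃ h : ℕ → X → ℝ, (∀ n, Continuous (h n)) ∧ (∀ n, ∀ x ∈ F, h n x = 1) ∧
      ∀ x ∉ F, ∃ U, IsOpen U ∧ x ∈ U ∧ ∃ N, ∀ n, N ≤ n → ∀ y ∈ U, h n y = 0 := by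
  let := TopologicalSpace.pseudoMetrizableSpacePseudoMetric X
  have hpos : ∀ n : ℕ, (0 : ℝ) < 1 / ((n : ℝ) + 1) := fun n => by positivity
  refine ⟨fun n x => thickenedIndicator (hpos n) F x, fun n =>
    NNReal.continuous_coe.comp (thickenedIndicator (hpos n) F).continuous, fun n x hx => ?_,
    fun x hx => ?_⟩
  · dsimp only
    rw [thickenedIndicator_one (hpos n) F hx, NNReal.coe_one]
  · have h0 : 0 < Metric.infEDist x F := by
      rw [pos_iff_ne_zero]
      exact fun h0 => hx (hF.closure_eq ▸ Metric.mem_closure_iff_infEDist_zero.2 h0)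
    obtain ⟨c, hc0, hc⟩ := ENNReal.lt_iff_exists_real_btwn.1 h0
    have hcpos : 0 < c := ENNReal.ofReal_pos.1 hc.1
    obtain ⟨N, hN⟩ := exists_nat_one_div_lt hcpos
    refine ⟨{y | ENNReal.ofReal c < Metric.infEDist y F},
      isOpen_lt continuous_const Metric.continuous_infEDist, hc.2, N, fun n hn y hy => ?_⟩
    have hy : ENNReal.ofReal c < Metric.infEDist y F := hy
    have hle : 1 / ((n : ℝ) + 1) ≤ 1 / ((N : ℝ) + 1) :=
      one_div_le_one_div_of_le (by positivity) (by exact_mod_cast Nat.succ_le_succ hn)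
    have hnot : y ∉ Metric.thickening (1 / ((n : ℝ) + 1)) F := by
      intro h
      have h : Metric.infEDist y F < ENNReal.ofReal (1 / ((n : ℝ) + 1)) := h
      exact (h.trans_le (ENNReal.ofReal_le_ofReal (hle.trans hN.le))).not_gt hy
    dsimp only
    rw [thickenedIndicator_zero (hpos n) F hnot, NNReal.coe_zero]

theorem tendsto_of_approx_indicator {F : Set X} {h : ℕ → X → ℝ}
    (h1 : ∀ n, ∀ x ∈ F, h n x = 1)
    (h0 : ∀ x ∉ F, ∃ U, IsOpen U ∧ x ∈ U ∧ ∃ N, ∀ n, N ≤ n → ∀ y ∈ U, h n y = 0) (x : X) :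
    Tendsto (fun n => h n x) atTop (𝓝 (F.indicator (fun _ => (1 : ℝ)) x)) := by
  by_cases hx : x ∈ F
  · simp only [h1 _ x hx, indicator_of_mem hx, tendsto_const_nhds_iff]
  · obtain ⟨U, -, hxU, N, hN⟩ := h0 x hx
    rw [indicator_of_notMem hx]
    exact tendsto_const_nhds.congr' (eventually_atTop.2 ⟨N, fun n hn => (hN n hn x hxU).symm⟩)

theorem isBaireClass_one_indicator [TopologicalSpace.PseudoMetrizableSpace X] {F : Set X}
    (hF : IsClosed F) : IsBaireClass 1 (F.indicator fun _ => (1 : ℝ)) := by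
  obtain ⟨h, hc, h1, h0⟩ := exists_continuous_approx_indicator hF
  exact isBaireClass_one_iff.2 ⟨h, hc, tendsto_of_approx_indicator h1 h0⟩

end Indicator

/-! ### Witnesses for the ranks -/

section Witness

variable {X Y : Type} [TopologicalSpace X] [TopologicalSpace Y]

/-- `β(f) ≤ θ`, in terms of indices. -/
def BetaWitness (f : X → ℝ) (θ : Ordinal.{0}) : Prop :=
  ∀ ε : ℝ, 0 < ε → HasIndex (OscSmall f ε) θ

/-- `γ(f) ≤ θ`, in terms of indices. -/
def GammaWitness (f : X → ℝ) (θ : Ordinal.{0}) : Prop :=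
  ∃ fs : ℕ → X → ℝ, (∀ n, Continuous (fs n)) ∧
    (∀ x, Tendsto (fun n => fs n x) atTop (𝓝 (f x))) ∧
    ∀ ε : ℝ, 0 < ε → HasIndex (SeqSmall fs ε) θ

theorem GammaWitness.betaWitness {f : X → ℝ} {θ : Ordinal.{0}} (h : GammaWitness f θ) :
    BetaWitness f θ := by
  obtain ⟨fs, hfs, hlim, hI⟩ := h
  exact fun ε hε => hasIndex_oscSmall_of_seqSmall hfs hlim hε (hI _ (by positivity))

theorem exists_gammaWitness [PolishSpace X] {f : X → ℝ} (hf : IsBaireClass 1 f) :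
    ∃ θ < ω₁, GammaWitness f θ := by
  obtain ⟨fs, hfs, hlim⟩ := isBaireClass_one_iff.1 hf
  obtain ⟨θ, hθ, hI⟩ := exists_hasIndex_seqSmall hfs hlim
  exact ⟨θ, hθ, fs, hfs, hlim, hI⟩

theorem BetaWitness.mono {f : X → ℝ} {θ θ' : Ordinal.{0}} (h : BetaWitness f θ) (hθ : θ ≤ θ') :
    BetaWitness f θ' :=
  fun ε hε => (h ε hε).mono_right hθ

theorem GammaWitness.mono {f : X → ℝ} {θ θ' : Ordinal.{0}} (h : GammaWitness f θ) (hθ : θ ≤ θ') :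
    GammaWitness f θ' :=
  let ⟨fs, hfs, hlim, hI⟩ := h
  ⟨fs, hfs, hlim, fun ε hε => (hI ε hε).mono_right hθ⟩

/-- The rank of a Baire class `1` function is countable, so the default value `ω₁` never occurs, and
a witness at the rank itself serves every larger `θ`. -/
theorem beta_le_iff [PolishSpace X] {f : X → ℝ} (hf : IsBaireClass 1 f) {θ : Ordinal.{0}} :
    beta f ≤ θ ↔ BetaWitness f θ := by
  refine ⟨fun h => ?_, beta_le⟩
  obtain ⟨θ', hθ', hW⟩ := exists_gammaWitness hf
  have hW' : BetaWitness f (beta f) := fun ε hε =>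
    hasIndex_of_beta_le le_rfl ((beta_le hW.betaWitness).trans_lt hθ') hε
  exact hW'.mono h

theorem gamma_le_iff [PolishSpace X] {f : X → ℝ} (hf : IsBaireClass 1 f) {θ : Ordinal.{0}} :
    gamma f ≤ θ ↔ GammaWitness f θ := by
  constructor
  · intro h
    obtain ⟨θ', hθ', fs, hfs, hlim, hI⟩ := exists_gammaWitness hf
    have hW' : GammaWitness f (gamma f) :=
      hasIndex_of_gamma_le ⟨fs, hfs, hlim⟩ le_rfl ((gamma_le hfs hlim hI).trans_lt hθ')
    exact hW'.mono h
  · rintro ⟨fs, hfs, hlim, hI⟩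
    exact gamma_le hfs hlim hI

theorem BetaWitness.comp {f : Y → ℝ} {θ : Ordinal.{0}} (hW : BetaWitness f θ) {h : X → Y}
    (hh : Continuous h) : BetaWitness (fun x => f (h x)) θ := by
  intro ε hε
  refine (hW ε hε).comp hh fun A hA => ?_
  obtain ⟨δ, hδ, H⟩ := hA
  exact ⟨δ, hδ, fun y hy z hz => H _ hy _ hz⟩

theorem GammaWitness.comp {f : Y → ℝ} {θ : Ordinal.{0}} (hW : GammaWitness f θ) {h : X → Y}
    (hh : Continuous h) : GammaWitness (fun x => f (h x)) θ := by
  obtain ⟨fs, hfs, hlim, hI⟩ := hW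
  refine ⟨fun n x => fs n (h x), fun n => (hfs n).comp hh, fun x => hlim (h x), fun ε hε => ?_⟩
  refine (hI ε hε).comp hh fun A hA => ?_
  obtain ⟨N, δ, hδ, H⟩ := hA
  exact ⟨N, δ, hδ, fun m hm n hn y hy => H m hm n hn _ hy⟩

theorem BetaWitness.const_mul {f : X → ℝ} {θ : Ordinal.{0}} (hW : BetaWitness f θ) {c : ℝ}
    (hc : c ≠ 0) : BetaWitness (fun x => c * f x) θ :=
  fun _ hε => (hW _ (div_pos hε (abs_pos.2 hc))).imp fun _ hA => hA.const_mul hc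

theorem GammaWitness.const_mul {f : X → ℝ} {θ : Ordinal.{0}} (hW : GammaWitness f θ) {c : ℝ}
    (hc : c ≠ 0) : GammaWitness (fun x => c * f x) θ := by
  obtain ⟨fs, hfs, hlim, hI⟩ := hW
  exact ⟨fun n x => c * fs n x, fun n => (hfs n).const_mul c, fun x => (hlim x).const_mul c,
    fun ε hε => (hI _ (div_pos hε (abs_pos.2 hc))).imp fun A hA => hA.const_mul hc⟩

theorem BetaWitness.add {f g : X → ℝ} {η : Ordinal.{0}} (hf : BetaWitness f (ω ^ η))
    (hg : BetaWitness g (ω ^ η)) : BetaWitness (fun x => f x + g x) (ω ^ η) :=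
  fun _ hε => .and (OscSmall.subset _ _) (OscSmall.subset _ _) (fun _ hA hA' => hA.add hA')
    (hf _ (half_pos hε)) (hg _ (half_pos hε))

theorem GammaWitness.add {f g : X → ℝ} {η : Ordinal.{0}} (hf : GammaWitness f (ω ^ η))
    (hg : GammaWitness g (ω ^ η)) : GammaWitness (fun x => f x + g x) (ω ^ η) := by
  obtain ⟨fs, hfs, hlim, hI⟩ := hf
  obtain ⟨gs, hgs, hlim', hI'⟩ := hg
  exact ⟨fun n x => fs n x + gs n x, fun n => (hfs n).add (hgs n),
    fun x => (hlim x).add (hlim' x), fun ε hε => .and (SeqSmall.subset _ _)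
      (SeqSmall.subset _ _) (fun A hA hA' => hA.add hA') (hI _ (half_pos hε)) (hI' _ (half_pos hε))⟩

theorem BetaWitness.mul_indicator {f : X → ℝ} {θ : Ordinal.{0}} (hW : BetaWitness f θ)
    (hθ : Order.IsSuccLimit θ) {F : Set X} (hF : IsClosed F) :
    BetaWitness (fun x => f x * F.indicator (fun _ => (1 : ℝ)) x) θ := by
  intro ε hε
  refine .inter_isClosed (OscSmall.subset _ _) (OscSmall.subset _ _) hF (fun A hA hs => ?_)
    (fun x hx => ⟨Fᶜ, hF.isOpen_compl, hx, 0, hε, fun y hy z hz => ?_⟩) hθ (hW ε hε)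
  · obtain ⟨δ, hδ, H⟩ := hs
    refine ⟨δ, hδ, fun y hy z hz => ?_⟩
    simpa [indicator_of_mem (hA hy), indicator_of_mem (hA hz)] using H y hy z hz
  · rw [indicator_of_notMem hy, indicator_of_notMem hz]
    simp

theorem GammaWitness.mul_indicator {f : X → ℝ} {θ : Ordinal.{0}} (hW : GammaWitness f θ)
    (hθ : Order.IsSuccLimit θ) {F : Set X} (hF : IsClosed F) {h : ℕ → X → ℝ}
    (hc : ∀ n, Continuous (h n)) (h1 : ∀ n, ∀ x ∈ F, h n x = 1)
    (h0 : ∀ x ∉ F, ∃ U, IsOpen U ∧ x ∈ U ∧ ∃ N, ∀ n, N ≤ n → ∀ y ∈ U, h n y = 0) :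
    GammaWitness (fun x => f x * F.indicator (fun _ => (1 : ℝ)) x) θ := by
  obtain ⟨fs, hfs, hlim, hI⟩ := hW
  refine ⟨fun n x => fs n x * h n x, fun n => (hfs n).mul (hc n), fun x =>
    (hlim x).mul (tendsto_of_approx_indicator h1 h0 x), fun ε hε => ?_⟩
  refine .inter_isClosed (SeqSmall.subset _ _) (SeqSmall.subset _ _) hF (fun A hA hs => ?_)
    (fun x hx => ?_) hθ (hI ε hε)
  · obtain ⟨N, δ, hδ, H⟩ := hs
    refine ⟨N, δ, hδ, fun m hm n hn y hy => ?_⟩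
    simpa [h1 _ y (hA hy)] using H m hm n hn y hy
  · obtain ⟨U, hU, hxU, N, hN⟩ := h0 x hx
    exact ⟨U, hU, hxU, N, 0, hε, fun m hm n hn y hy => by simp [hN m hm y hy, hN n hn y hy]⟩

end Witness

/-! ### Ranks presented by witnesses -/

section Rank

/-- The rank `ρ` is given by minimization over the refinements: `ρ f ≤ θ` is witnessed by
`W τ' f θ` for some `τ'`, where `W` has the permanence properties of the ranks `β` and `γ`. -/
structure IsWitnessed {X : Type} (τ : TopologicalSpace X) (ξ : Ordinal.{0})
    (ρ : (X → ℝ) → Ordinal.{0}) (W : TopologicalSpace X → (X → ℝ) → Ordinal.{0} → Prop) :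
    Prop where
  lt_omega_one : ∀ f, IsBaireClass ξ f → ρ f < ω₁
  le_iff : ∀ f, IsBaireClass ξ f → ∀ θ, ρ f ≤ θ ↔
    ∃ τ' ∈ @refinements X τ ξ f, W τ' f θ
  comp : ∀ (τ₁ τ₂ : TopologicalSpace X) (h : X → X), Continuous[τ₁, τ₂] h → ∀ f θ,
    W τ₂ f θ → W τ₁ (fun x => f (h x)) θ
  const_mul : ∀ τ' f θ, ∀ c : ℝ, c ≠ 0 → W τ' f θ → W τ' (fun x => c * f x) θ
  add : ∀ τ' f g, ∀ η : Ordinal.{0}, W τ' f (ω ^ η) → W τ' g (ω ^ η) →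
    W τ' (fun x => f x + g x) (ω ^ η)
  mul_indicator : ∀ τ' ≤ τ, ∀ f θ, Order.IsSuccLimit θ → W τ' f θ →
    ∀ F : Set X, IsClosed[τ] F → W τ' (fun x => f x * F.indicator (fun _ => (1 : ℝ)) x) θ
  hasIndex : ∀ τ' f θ, W τ' f θ → @HasIndex X τ' (OscSmall f 1) θ

theorem mem_refinements_comp {X : Type} [τ : TopologicalSpace X] {ξ : Ordinal.{0}} {f : X → ℝ}
    {τ' : TopologicalSpace X} (hτ' : τ' ∈ @refinements X τ ξ f) (e : X ≃ X)
    (he : τ.induced e = τ) : τ'.induced e ∈ @refinements X τ ξ fun x => f (e x) := by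
  obtain ⟨hle, hP, hS, hf⟩ := hτ'
  refine ⟨?_, @Equiv.polishSpace_induced X X τ' hP e, ?_, ?_⟩
  · conv_rhs => rw [← he]
    exact induced_mono hle
  · rintro U ⟨V, hV, rfl⟩
    exact @IsSigma0.preimage X X τ τ ξ V (hS V hV) e (continuous_iff_le_induced.2 he.ge)
  · exact @IsBaireClass.comp_continuous X X (τ'.induced e) τ' 1 f hf e continuous_induced_dom

namespace IsWitnessed

variable {ξ : Ordinal.{0}} {ρ : (ℝ → ℝ) → Ordinal.{0}}
  {W : TopologicalSpace ℝ → (ℝ → ℝ) → Ordinal.{0} → Prop}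

theorem translate_le (h : IsWitnessed inferInstance ξ ρ W) {f : ℝ → ℝ}
    (hf : IsBaireClass ξ f) (t : ℝ) : ρ (fun x => f (x + t)) ≤ ρ f := by
  have hft : IsBaireClass ξ fun x => f (x + t) :=
    hf.comp_continuous (continuous_id.add continuous_const)
  have he := (Homeomorph.addRight t).isInducing.eq_induced.symm
  have mem := @mem_refinements_comp ℝ inferInstance ξ f
  obtain ⟨τ', hτ', hW⟩ := (h.le_iff f hf _).1 le_rfl
  exact (h.le_iff _ hft _).2 ⟨_, mem hτ' (Equiv.addRight t) he,
    h.comp _ τ' (· + t) continuous_induced_dom f _ hW⟩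

theorem const_mul_le (h : IsWitnessed inferInstance ξ ρ W) {f : ℝ → ℝ}
    (hf : IsBaireClass ξ f) {c : ℝ} (hc : c ≠ 0) : ρ (fun x => c * f x) ≤ ρ f := by
  have hcf : IsBaireClass ξ fun x => c * f x := (isBaireClass_const ξ c).mul hf
  have hmul : Continuous (Function.uncurry fun a b : ℝ => a * b) := continuous_mul
  obtain ⟨τ', ⟨hle, hP, hS, h1⟩, hW⟩ := (h.le_iff f hf _).1 le_rfl
  exact (h.le_iff _ hcf _).2 ⟨τ', ⟨hle, hP, hS,
    @IsBaireClass.map₂ ℝ τ' (fun a b => a * b) hmul 1 _ _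
      (@isBaireClass_const ℝ τ' 1 c) h1⟩, h.const_mul _ _ _ _ hc hW⟩

/-- Unboundedness uses only the index for `ε = 1`, which both kinds of witness supply, so one
diagonal function serves both ranks. -/
theorem isRequiredRank (h : IsWitnessed inferInstance ξ ρ W) (hξ : 1 ≤ ξ) (hξ' : ξ < ω₁) :
    IsRequiredRank ξ ρ := by
  have perfect : ∀ P : Set ℝ, Perfect P → P.Nonempty → ∀ ζ : Ordinal.{0}, ζ < ω₁ →
      ∃ f : ℝ → ℝ, IsBaireClass ξ f ∧ (∀ x, x ∉ P → f x = 0) ∧ ζ ≤ ρ f := by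
    intro P hP hne ζ hζ
    obtain ⟨f, hf, hfP, hfT⟩ := exists_isBaireClass_not_hasIndex hξ hξ' hP hne hζ
    refine ⟨f, hf, hfP, le_of_not_ge fun hle => ?_⟩
    obtain ⟨τ', hτ', hW⟩ := (h.le_iff f hf ζ).1 hle
    exact hfT τ' hτ' (h.hasIndex _ _ _ hW)
  refine ⟨h.lt_omega_one, fun ζ hζ => ?_, perfect, fun f hf t => ?_, fun f hf c hc => ?_,
    fun f g hf hg => ?_, fun f hf F hF => ?_⟩
  · obtain ⟨f, hf, -, hfζ⟩ := perfect univ (PerfectSpace.univ_perfect ℝ) univ_nonempty ζ hζ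
    exact ⟨f, hf, hfζ⟩
  · have hft : IsBaireClass ξ fun x => f (x + t) :=
      hf.comp_continuous (continuous_id.add continuous_const)
    refine ⟨hft, (h.translate_le hf t).antisymm ?_⟩
    simpa using h.translate_le hft (-t)
  · have hcf : IsBaireClass ξ fun x => c * f x := (isBaireClass_const ξ c).mul hf
    have h1 := h.const_mul_le hf hc
    have h2 : ρ f ≤ ρ fun x => c * f x := by
      simpa [← mul_assoc, inv_mul_cancel₀ hc] using h.const_mul_le hcf (inv_ne_zero hc)
    exact ⟨hcf, fun η _ _ hle => h1.trans hle, fun η _ _ hle => h2.trans hle⟩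
  · have hfg := hf.add hg
    refine ⟨hfg, fun η _ _ hle => ?_⟩
    -- The minimizing topologies of `f` and `g` may differ. Both witnesses pass to a common
    -- refinement along the continuous identity map, and are added there.
    have join := @exists_isRefinement_forall_le ℝ inferInstance inferInstance ξ hξ Bool
      inferInstance
    obtain ⟨τ₁, ⟨hle₁, hP₁, hS₁, hf₁⟩, hW₁⟩ := (h.le_iff f hf _).1 ((le_max_left _ _).trans hle)
    obtain ⟨τ₂, ⟨hle₂, hP₂, hS₂, hg₂⟩, hW₂⟩ := (h.le_iff g hg _).1 ((le_max_right _ _).trans hle)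
    obtain ⟨τ', ⟨hle', hP', hS'⟩, hτ'⟩ := @join (fun b => cond b τ₁ τ₂)
      (Bool.rec ⟨hle₂, hP₂, hS₂⟩ ⟨hle₁, hP₁, hS₁⟩)
    have h₁ : τ' ≤ τ₁ := hτ' true
    have h₂ : τ' ≤ τ₂ := hτ' false
    refine (h.le_iff _ hfg _).2 ⟨τ', ⟨hle', hP', hS',
      @IsBaireClass.add ℝ τ' 1 f g (@IsBaireClass.of_le ℝ τ₁ τ' h₁ 1 f hf₁)
        (@IsBaireClass.of_le ℝ τ₂ τ' h₂ 1 g hg₂)⟩, ?_⟩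
    exact h.add τ' f g η (h.comp τ' τ₁ id (continuous_id_of_le h₁) f _ hW₁)
      (h.comp τ' τ₂ id (continuous_id_of_le h₂) g _ hW₂)
  · have h1F := isBaireClass_one_indicator hF
    have hfF := hf.mul (h1F.mono hξ)
    refine ⟨hfF, fun η hη _ hle => ?_⟩
    obtain ⟨τ', ⟨hle', hP, hS, h1⟩, hW⟩ := (h.le_iff f hf _).1 hle
    refine (h.le_iff _ hfF _).2 ⟨τ', ⟨hle', hP, hS,
      @IsBaireClass.mul ℝ τ' 1 _ _ h1 (@IsBaireClass.of_le ℝ _ τ' hle' 1 _ h1F)⟩, ?_⟩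
    exact h.mul_indicator τ' hle' f _ (Ordinal.isSuccLimit_opow_left Ordinal.isSuccLimit_omega0
      (zero_lt_one.trans_le hη).ne') hW F hF

end IsWitnessed

variable {X : Type} [τ : TopologicalSpace X] [PolishSpace X] {ξ : Ordinal.{0}}

theorem isWitnessed_sInf (hξ : 1 ≤ ξ) (r : TopologicalSpace X → (X → ℝ) → Ordinal.{0})
    {W : TopologicalSpace X → (X → ℝ) → Ordinal.{0} → Prop}
    (hW : ∀ τ' f, @PolishSpace X τ' → @IsBaireClass X τ' 1 f → ∀ θ, r τ' f ≤ θ ↔ W τ' f θ)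
    (hlt : ∀ τ' f, @PolishSpace X τ' → @IsBaireClass X τ' 1 f → r τ' f < ω₁)
    {f : X → ℝ} (hf : @IsBaireClass X τ ξ f) :
    sInf {θ : Ordinal.{0} | ∃ τ' ∈ @refinements X τ ξ f, θ = r τ' f} < ω₁ ∧
      ∀ θ, sInf {θ : Ordinal.{0} | ∃ τ' ∈ @refinements X τ ξ f, θ = r τ' f} ≤ θ ↔
        ∃ τ' ∈ @refinements X τ ξ f, W τ' f θ := by
  obtain ⟨τ₀, hτ₀⟩ := refinements_nonempty hξ hf
  obtain ⟨τ₁, hτ₁, he⟩ := csInf_mem (s := {θ : Ordinal.{0} | ∃ τ' ∈ @refinements X τ ξ f,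
    θ = r τ' f}) ⟨_, τ₀, hτ₀, rfl⟩
  rw [he]
  refine ⟨hlt τ₁ f hτ₁.2.1 hτ₁.2.2.2, fun θ => ⟨fun hθ => ?_, ?_⟩⟩
  · exact ⟨τ₁, hτ₁, (hW τ₁ f hτ₁.2.1 hτ₁.2.2.2 θ).1 hθ⟩
  · rintro ⟨τ', hτ', h⟩
    rw [← he]
    refine le_trans (csInf_le' ?_) ((hW τ' f hτ'.2.1 hτ'.2.2.2 θ).2 h)
    exact ⟨τ', hτ', rfl⟩

theorem isWitnessed_betaStar (hξ : 1 ≤ ξ) :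
    IsWitnessed τ ξ (betaStar (X := X) ξ) fun τ' => @BetaWitness X τ' := by
  have key := fun f => isWitnessed_sInf (X := X) (f := f) hξ (fun τ' f => @beta X τ' f)
    (W := fun τ' => @BetaWitness X τ') (fun τ' f hP hf θ => beta_le_iff hf) fun τ' f hP hf => by
      obtain ⟨θ, hθ, hW⟩ := exists_gammaWitness hf
      exact ((beta_le_iff hf).2 hW.betaWitness).trans_lt hθ
  exact
    { lt_omega_one := fun f hf => (key f hf).1
      le_iff := fun f hf => (key f hf).2
      comp := fun τ₁ τ₂ h hh f θ hW => @BetaWitness.comp X X τ₁ τ₂ f θ hW h hh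
      const_mul := fun τ' f θ c hc hW => hW.const_mul hc
      add := fun τ' f g η hf hg => hf.add hg
      mul_indicator := fun τ' hτ' f θ hθ hW F hF => hW.mul_indicator hθ (hF.mono hτ')
      hasIndex := fun τ' f θ hW => hW 1 one_pos }

theorem isWitnessed_gammaStar (hξ : 1 ≤ ξ) :
    IsWitnessed τ ξ (gammaStar (X := X) ξ) fun τ' => @GammaWitness X τ' := by
  have key := fun f => isWitnessed_sInf (X := X) (f := f) hξ (fun τ' f => @gamma X τ' f)
    (W := fun τ' => @GammaWitness X τ') (fun τ' f hP hf θ => gamma_le_iff hf) fun τ' f hP hf => by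
      obtain ⟨θ, hθ, hW⟩ := exists_gammaWitness hf
      exact ((gamma_le_iff hf).2 hW).trans_lt hθ
  exact
    { lt_omega_one := fun f hf => (key f hf).1
      le_iff := fun f hf => (key f hf).2
      comp := fun τ₁ τ₂ h hh f θ hW => @GammaWitness.comp X X τ₁ τ₂ f θ hW h hh
      const_mul := fun τ' f θ c hc hW => hW.const_mul hc
      add := fun τ' f g η hf hg => hf.add hg
      mul_indicator := fun τ' hτ' f θ hθ hW F hF => by
        -- The approximations are chosen for the original topology; continuity and local vanishing
        -- persist in the finer `τ'`.
        obtain ⟨h, hc, h1, h0⟩ := @exists_continuous_approx_indicator X τ _ F hF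
        refine hW.mul_indicator hθ (hF.mono hτ') (fun n => continuous_le_dom hτ' (hc n)) h1
          fun x hx => ?_
        obtain ⟨U, hU, h⟩ := h0 x hx
        exact ⟨U, hτ' _ hU, h⟩
      hasIndex := fun τ' f θ hW => hW.betaWitness 1 one_pos }

end Rank

end BaireRank

theorem mainTheorem4 (ξ : Ordinal.{0}) (hξ : 1 ≤ ξ) (hξ' : ξ < ω₁) :
    (∀ f : ℝ → ℝ, BaireRank.IsBaireClass ξ f → (BaireRank.refinements ξ f).Nonempty) ∧
      BaireRank.IsRequiredRank ξ (BaireRank.betaStar ξ) ∧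
      BaireRank.IsRequiredRank ξ (BaireRank.gammaStar ξ) :=
  ⟨fun _ hf => BaireRank.refinements_nonempty hξ hf,
    (BaireRank.isWitnessed_betaStar hξ).isRequiredRank hξ hξ',
    (BaireRank.isWitnessed_gammaStar hξ).isRequiredRank hξ hξ'⟩
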